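/- Let $H^1(\mathbb{R})$ be the real Sobolev space; elements are identified with their continuous representatives. For $b\in\mathbb{R}$, $c>0$, a function $u\in H^1(\mathbb{R})$ is a weak solution of $(1-bu^2)u''=cu$ if $$c\langle u,\varphi\rangle+\langle(1-bu^2)u',\varphi'\rangle-2b\langle u(u')^2,\varphi\rangle=0\quad\text{for every }\varphi\in H^1(\mathbb{R}),$$ where $\langle\cdot,\cdot\rangle$ is the $L^2(\mathbb{R})$ pairing. It is positive if $u(x)>0$ for all $x\in\mathbb{R}$, and single-humped if there is exactly one point $x_0$ with $u(x_0)=\max_{x\in\mathbb{R}}u(x)$. The energy space $X$ consists of those $u\in H^1(\mathbb{R})$ for which $\log|1-bu^2|$ is integrable over $\mathbb{R}$. Theorem. Fix $c>0$. (i) For $b<0$ there are no positive single-humped weak solutions in $H^1(\mathbb{R})$. (ii) For each $b>0$ there is a one-parameter family $(u_C)_{C\in[-\infty,\infty)}$ of positive single-humped weak solutions, all in $X$, such that $C\mapsto u_C$ is injective and continuous from $[-\infty,\infty)$ to $H^1(\mathbb{R})$. The family is $u_C(x)=b^{-1/2}U_C(\sqrt{c}\,x)$ with $U_C$ as follows.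 The cusped soliton $U_{-\infty}$ has $0<U_{-\infty}\le1$ and is given by $$|x|=\int_{U_{-\infty}(x)}^1\frac{d\xi}{\sqrt{-\log(1-\xi^2)}},\qquad x\in\mathbb{R}.$$ For $C\in\mathbb{R}$ put $\ell_C=\int_1^{\sqrt{1+e^{2C}}}\frac{d\xi}{\sqrt{2C-\log(\xi^2-1)}}$. Then $U_C(x)=U_{-\infty}(|x|-\ell_C)$ for $|x|>\ell_C$, while for $|x|\le\ell_C$ one has $1\le U_C(x)\le\sqrt{1+e^{2C}}$ and $$\ell_C-|x|=\int_1^{U_C(x)}\frac{d\xi}{\sqrt{2C-\log(\xi^2-1)}}.$$ The bell-shaped soliton is $U_0$. -/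

import Mathlib

open MeasureTheory Set Filter Topology
open scoped ContDiff

noncomputable section

/-- `g` is the weak derivative of `f` on the line:
`∫ f φ' = - ∫ g φ` for every smooth compactly supported `φ`. -/
def IsWeakDeriv (f g : ℝ → ℝ) : Prop :=
  ∀ φ : ℝ → ℝ, ContDiff ℝ ∞ φ → HasCompactSupport φ →
    ∫ x, f x * deriv φ x = -∫ x, g x * φ x

theorem integrable_L2_mul (f : Lp ℝ 2 (volume : Measure ℝ)) {φ : ℝ → ℝ}
    (h1 : Continuous φ) (h2 : HasCompactSupport φ) :
    Integrable (fun x => f x * φ x) :=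
  MemLp.integrable_mul (p := 2) (q := 2) (Lp.memLp f) (h1.memLp_of_hasCompactSupport h2)

/-- The real Sobolev space `H¹(ℝ)`: pairs `(u, u')` of elements of `L²(ℝ)` such that `u'` is the
weak derivative of `u` (which determines `u'`), with the Hilbert norm
`‖u‖² = ‖u‖²_{L²} + ‖u'‖²_{L²}`. -/
def H1 : Submodule ℝ
    (WithLp 2 (Lp ℝ 2 (volume : Measure ℝ) × Lp ℝ 2 (volume : Measure ℝ))) where
  carrier := {p | IsWeakDeriv p.fst p.snd}
  zero_mem' := by
    intro φ _ _
    have h : (⇑(0 : Lp ℝ 2 (volume : Measure ℝ)) : ℝ → ℝ) =ᵐ[volume] 0 := Lp.coeFn_zero _ _ _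
    have e1 : ∫ x, (0 : Lp ℝ 2 (volume : Measure ℝ)) x * deriv φ x = 0 := by
      rw [integral_congr_ae (g := fun _ => (0 : ℝ)) (by filter_upwards [h] with x hx; rw [hx]; simp)]
      simp
    have e2 : ∫ x, (0 : Lp ℝ 2 (volume : Measure ℝ)) x * φ x = 0 := by
      rw [integral_congr_ae (g := fun _ => (0 : ℝ)) (by filter_upwards [h] with x hx; rw [hx]; simp)]
      simp
    change ∫ x, (0 : Lp ℝ 2 (volume : Measure ℝ)) x * deriv φ x
      = -∫ x, (0 : Lp ℝ 2 (volume : Measure ℝ)) x * φ x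
    rw [e1, e2, neg_zero]
  add_mem' := by
    intro p q hp hq φ h1 h2
    have hd : Continuous (deriv φ) := h1.continuous_deriv (by simp)
    have key : ∀ (f g : Lp ℝ 2 (volume : Measure ℝ)) (χ : ℝ → ℝ), Continuous χ →
        HasCompactSupport χ →
        ∫ x, (f + g : Lp ℝ 2 (volume : Measure ℝ)) x * χ x
          = (∫ x, f x * χ x) + ∫ x, g x * χ x := by
      intro f g χ c1 c2
      rw [← integral_add (integrable_L2_mul f c1 c2) (integrable_L2_mul g c1 c2)]
      apply integral_congr_ae
      filter_upwards [Lp.coeFn_add f g] with x hx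
      rw [hx, Pi.add_apply, add_mul]
    change ∫ x, (p.fst + q.fst : Lp ℝ 2 (volume : Measure ℝ)) x * deriv φ x
      = -∫ x, (p.snd + q.snd : Lp ℝ 2 (volume : Measure ℝ)) x * φ x
    rw [key _ _ _ hd h2.deriv, key _ _ _ h1.continuous h2, hp φ h1 h2, hq φ h1 h2]
    ring
  smul_mem' := by
    intro a p hp φ h1 h2
    have key : ∀ (f : Lp ℝ 2 (volume : Measure ℝ)) (χ : ℝ → ℝ),
        ∫ x, (a • f : Lp ℝ 2 (volume : Measure ℝ)) x * χ x = a * ∫ x, f x * χ x := by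
      intro f χ
      rw [← integral_const_mul]
      apply integral_congr_ae
      filter_upwards [Lp.coeFn_smul a f] with x hx
      rw [hx, Pi.smul_apply, smul_eq_mul, mul_assoc]
    change ∫ x, (a • p.fst : Lp ℝ 2 (volume : Measure ℝ)) x * deriv φ x
      = -∫ x, (a • p.snd : Lp ℝ 2 (volume : Measure ℝ)) x * φ x
    rw [key, key, hp φ h1 h2]
    ring

/-- The function `u` underlying an element of `H¹(ℝ)` (defined up to null sets). -/
def h1Fun (u : H1) : ℝ → ℝ := ⇑u.val.fst

/-- The weak derivative `u'` of an element of `H¹(ℝ)` (defined up to null sets). -/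
def h1Deriv (u : H1) : ℝ → ℝ := ⇑u.val.snd

/-- `u ∈ H¹(ℝ)` is a weak solution of `c u = (1 - b u²) u''`:
`c ⟨u, φ⟩ + ⟨(1 - b u²) u', φ'⟩ - 2 b ⟨u (u')², φ⟩ = 0` for every `φ ∈ H¹(ℝ)`.
All three integrals converge absolutely, because elements of `H¹(ℝ)` are bounded. -/
def IsWeakSolution (b c : ℝ) (u : H1) : Prop :=
  ∀ φ : H1,
    c * (∫ x, h1Fun u x * h1Fun φ x) + (∫ x, (1 - b * h1Fun u x ^ 2) * h1Deriv u x * h1Deriv φ x)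
      - 2 * b * (∫ x, h1Fun u x * h1Deriv u x ^ 2 * h1Fun φ x) = 0

/-- `f` is the continuous representative of `u ∈ H¹(ℝ)` (it is unique); pointwise properties of
`u` refer to it. -/
def IsContRep (u : H1) (f : ℝ → ℝ) : Prop :=
  Continuous f ∧ h1Fun u =ᵐ[volume] f

/-- `u(x) > 0` for every `x`. -/
def IsPositive (u : H1) : Prop :=
  ∃ f, IsContRep u f ∧ ∀ x, 0 < f x

/-- There is exactly one point at which `u` attains its maximum over the line. -/
def IsSingleHumped (u : H1) : Prop :=
  ∃ f, IsContRep u f ∧ ∃! x₀, ∀ x, f x ≤ f x₀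

/-- The energy space `X`: those `u ∈ H¹(ℝ)` for which `∫ log |1 - b u²| dx` converges. -/
def energySpace (b : ℝ) : Set H1 :=
  {u | Integrable (fun x => Real.log |1 - b * h1Fun u x ^ 2|)}

/-- The cusped soliton for `b = c = 1`: `0 < U ≤ 1` and
`|x| = ∫_{U(x)}^1 dξ / √(-log (1 - ξ²))`. -/
def IsCuspedSoliton (U : ℝ → ℝ) : Prop :=
  ∀ x, 0 < U x ∧ U x ≤ 1 ∧
    |x| = ∫ ξ in (U x)..1, 1 / Real.sqrt (-Real.log (1 - ξ ^ 2))

/-- The height `√(1 + e^{2C})` of the soliton with parameter `C`, for `b = c = 1`. -/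
def headHeight (C : ℝ) : ℝ := Real.sqrt (1 + Real.exp (2 * C))

/-- The half-width `ℓ_C = ∫_1^{√(1 + e^{2C})} dξ / √(2C - log (ξ² - 1))` of the head. -/
def headWidth (C : ℝ) : ℝ :=
  ∫ ξ in (1 : ℝ)..headHeight C, 1 / Real.sqrt (2 * C - Real.log (ξ ^ 2 - 1))

/-- The soliton with real parameter `C` for `b = c = 1`: on `|x| ≤ ℓ_C` it takes values in
`[1, √(1 + e^{2C})]` and `ℓ_C - |x| = ∫_1^{U(x)} dξ / √(2C - log (ξ² - 1))`; on `|x| > ℓ_C` it is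
the cusped soliton at `|x| - ℓ_C`. The bell-shaped soliton is the case `C = 0`. -/
def IsSoliton (C : ℝ) (U : ℝ → ℝ) : Prop :=
  (∀ x, |x| ≤ headWidth C → 1 ≤ U x ∧ U x ≤ headHeight C ∧
    headWidth C - |x|
      = ∫ ξ in (1 : ℝ)..(U x), 1 / Real.sqrt (2 * C - Real.log (ξ ^ 2 - 1))) ∧
  ∃ V, IsCuspedSoliton V ∧ ∀ x, headWidth C < |x| → U x = V (|x| - headWidth C)

/-- `u ∈ H¹(ℝ)` is the rescaled profile `u(x) = b^{-1/2} U(√c x)`. -/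
def IsRescaled (b c : ℝ) (u : H1) (U : ℝ → ℝ) : Prop :=
  h1Fun u =ᵐ[volume] fun x => (Real.sqrt b)⁻¹ * U (Real.sqrt c * x)

end

/-! For `b < 0`, testing the equation with `u` itself produces a vanishing sum of three nonnegative
terms, so `u = 0` almost everywhere.

For `b > 0`, scaling reduces everything to `b = c = 1`. Multiplying `(1 - U²) U'' = U` by `U' / (1 -
U²)` and integrating gives `U'² = const - log |1 - U²|`. Decay at infinity selects the constant `0`
on the tail `U < 1`, but since the equation degenerates at `U = 1` the constant `2C` on the head `U
> 1` is free. With `W = -U'` and `a = e^{2C}` this reads `U² - 1 = a e^{-W²}` on the head and `U² -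
1 = -e^{-W²}` on the tail.

The slope `W` is taken as the coordinate. From `W' = U / (U² - 1)`, the density `|dx/dW|` is an
explicit function with Gaussian decay (`headKernel`, `tailKernel`), and the singular points `U = 1`
move to `W = ±∞`. Integrating the kernels gives position as a function of slope, and inverting that
gives the soliton; `a = 0` is the cusped one, whose head has length zero.

At `U = 1` the derivative is unbounded, but the flux `(1 - U²) U' = (U² - 1) W` tends to `0`. So the
flux is absolutely continuous with square integrable derivative (`isIndefIntegral_flux`), no point
mass arises where head and tail meet, and integration by parts yields the weak equation.

By `integral_comp_slope`, integrals over `x` become integrals over the slope in which only the head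
part depends on `a`. This gives membership in `H¹` and `X`, and dominated convergence makes the `L²`
norms of `U` and `U'` continuous in `a`; with pointwise convergence, `tendsto_integral_sub_sq`
upgrades this to continuity in `H¹`. Injectivity is read off from the height `√(1 + a)`. -/

noncomputable section

/-! ### Absolutely continuous functions on the line and integration by parts. -/

/-- `F` is an indefinite integral of the locally integrable function `G`. -/
structure IsIndefIntegral (F G : ℝ → ℝ) : Prop where
  locallyIntegrable : LocallyIntegrable G
  sub_eq : ∀ x y, F y - F x = ∫ t in x..y, G t

namespace IsIndefIntegral

variable {F G Φ Ψ : ℝ → ℝ}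

theorem intervalIntegrable (h : IsIndefIntegral F G) (a b : ℝ) : IntervalIntegrable G volume a b :=
  (h.locallyIntegrable.integrableOn_isCompact isCompact_uIcc).intervalIntegrable

theorem eq_add (h : IsIndefIntegral F G) (a : ℝ) : F = fun y => F a + ∫ t in a..y, G t := by
  funext y
  rw [← h.sub_eq a y]; ring

theorem absolutelyContinuousOnInterval (h : IsIndefIntegral F G) (a b : ℝ) :
    AbsolutelyContinuousOnInterval F a b := by
  have h1 := (h.intervalIntegrable a b).absolutelyContinuousOnInterval_intervalIntegral
    (c := a) (by simp)
  have h2 : AbsolutelyContinuousOnInterval (fun _ : ℝ => F a) a b :=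
    (contDiff_const (n := 1)).contDiffOn.absolutelyContinuousOnInterval
  have h3 := h2.fun_add h1
  rw [h.eq_add a]
  simpa using h3

theorem continuous (h : IsIndefIntegral F G) : Continuous F := by
  rw [h.eq_add 0]
  exact continuous_const.add
    (intervalIntegral.continuous_primitive (fun a b => h.intervalIntegrable a b) 0)

theorem ae_hasDerivAt (h : IsIndefIntegral F G) : ∀ᵐ x, HasDerivAt F (G x) x := by
  filter_upwards [LocallyIntegrable.ae_hasDerivAt_integral h.locallyIntegrable] with x hx
  rw [h.eq_add 0]
  exact (hx 0).const_add _

theorem integral_mul_add_mul (h : IsIndefIntegral F G) (h' : IsIndefIntegral Φ Ψ) (a b : ℝ) :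
    ∫ x in a..b, (G x * Φ x + F x * Ψ x) = F b * Φ b - F a * Φ a := by
  rw [← (h.absolutelyContinuousOnInterval a b).integral_deriv_mul_eq_sub
    (h'.absolutelyContinuousOnInterval a b)]
  apply intervalIntegral.integral_congr_ae
  filter_upwards [h.ae_hasDerivAt, h'.ae_hasDerivAt] with x h1 h2 _
  rw [h1.deriv, h2.deriv]

/-- Integration by parts on the line. -/
theorem integral_mul_eq_neg (h : IsIndefIntegral F G) (h' : IsIndefIntegral Φ Ψ)
    (h0 : Integrable (fun x => F x * Φ x)) (h1 : Integrable (fun x => G x * Φ x))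
    (h2 : Integrable (fun x => F x * Ψ x)) :
    ∫ x, F x * Ψ x = -∫ x, G x * Φ x := by
  have hint : Integrable (fun x => G x * Φ x + F x * Ψ x) := h1.add h2
  have top : Tendsto (fun y => F y * Φ y) atTop
      (𝓝 (F 0 * Φ 0 + ∫ x in Ioi 0, (G x * Φ x + F x * Ψ x))) := by
    have := intervalIntegral_tendsto_integral_Ioi 0 hint.integrableOn tendsto_id
    simp only [id, h.integral_mul_add_mul h'] at this
    simpa using this.const_add (F 0 * Φ 0)
  have bot : Tendsto (fun y => F y * Φ y) atBot
      (𝓝 (F 0 * Φ 0 - ∫ x in Iic 0, (G x * Φ x + F x * Ψ x))) := by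
    have := intervalIntegral_tendsto_integral_Iic 0 hint.integrableOn tendsto_id
    simp only [id, h.integral_mul_add_mul h'] at this
    simpa using this.const_sub (F 0 * Φ 0)
  -- An integrable function that has a limit at `±∞` has limit zero, because half-lines have
  -- infinite measure; so the boundary terms vanish.
  have e1 := IntegrableAtFilter.eq_zero_of_tendsto (μ := volume)
    (h0.integrableAtFilter atTop) (by
      intro s hs
      obtain ⟨r, hr⟩ := mem_atTop_sets.1 hs
      exact top_unique (by rw [← Real.volume_Ici (a := r)]; exact measure_mono hr)) top
  have e2 := IntegrableAtFilter.eq_zero_of_tendsto (μ := volume)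
    (h0.integrableAtFilter atBot) (by
      intro s hs
      obtain ⟨r, hr⟩ := mem_atBot_sets.1 hs
      exact top_unique (by rw [← Real.volume_Iic (a := r)]; exact measure_mono hr)) bot
  have e3 : ∫ x, (G x * Φ x + F x * Ψ x) = 0 := by
    rw [← intervalIntegral.integral_Iic_add_Ioi (b := 0) hint.integrableOn hint.integrableOn]
    linarith
  rw [integral_add h1 h2] at e3
  linarith

theorem integral_mul_eq_neg_of_memLp (h : IsIndefIntegral F G) (h' : IsIndefIntegral Φ Ψ)
    (hF : MemLp F 2) (hG : MemLp G 2) (hΦ : MemLp Φ 2) (hΨ : MemLp Ψ 2) :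
    ∫ x, F x * Ψ x = -∫ x, G x * Φ x :=
  h.integral_mul_eq_neg h' (hF.integrable_mul hΦ) (hG.integrable_mul hΦ) (hF.integrable_mul hΨ)

theorem of_contDiff {χ : ℝ → ℝ} (hχ : ContDiff ℝ ∞ χ) : IsIndefIntegral χ (deriv χ) where
  locallyIntegrable := (hχ.continuous_deriv (by simp)).locallyIntegrable
  sub_eq x y := by
    rw [intervalIntegral.integral_deriv_eq_sub (fun t _ => (hχ.differentiable (by simp)) t)
      ((hχ.continuous_deriv (by simp)).intervalIntegrable _ _)]

/-- Integration by parts against a test function. -/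
theorem integral_mul_deriv_eq_neg (h : IsIndefIntegral F G) {χ : ℝ → ℝ} (hχ : ContDiff ℝ ∞ χ)
    (hs : HasCompactSupport χ) : ∫ x, F x * deriv χ x = -∫ x, G x * χ x := by
  have hc := hχ.continuous_deriv (n := ∞) (by simp)
  refine h.integral_mul_eq_neg (of_contDiff hχ) ?_ ?_ ?_
  · exact (h.continuous.mul hχ.continuous).integrable_of_hasCompactSupport hs.mul_left
  · simpa [mul_comm] using
      h.locallyIntegrable.integrable_smul_left_of_hasCompactSupport hχ.continuous hs
  · exact (h.continuous.mul hc).integrable_of_hasCompactSupport hs.deriv.mul_left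

/-- Meant for the profile and its flux, which are continuous everywhere but differentiated only off
the points `|x| = headLength a`. -/
theorem of_hasDerivAt_off_countable {s : Set ℝ} (hs : s.Countable) (hF : Continuous F)
    (hd : ∀ x ∉ s, HasDerivAt F (G x) x) (hG : LocallyIntegrable G) : IsIndefIntegral F G where
  locallyIntegrable := hG
  sub_eq _ _ := (integral_eq_of_hasDerivAt_off_countable F G hs hF.continuousOn
    (fun t ht => hd t ht.2)
    (hG.integrableOn_isCompact isCompact_uIcc).intervalIntegrable).symm

end IsIndefIntegral

/-! ### Weak derivatives and absolutely continuous representatives in `H¹`. -/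

/-- A compactly supported smooth function with vanishing integral has a compactly supported smooth
primitive. -/
theorem exists_compactSupport_primitive {θ : ℝ → ℝ} (hθ : ContDiff ℝ ∞ θ)
    (hs : HasCompactSupport θ) (h0 : ∫ x, θ x = 0) :
    ∃ χ : ℝ → ℝ, ContDiff ℝ ∞ χ ∧ HasCompactSupport χ ∧ deriv χ = θ := by
  have hint := hθ.continuous.integrable_of_hasCompactSupport (μ := volume) hs
  obtain ⟨R, hR⟩ : ∃ R, tsupport θ ⊆ Icc (-R) R := by
    obtain ⟨R, hR⟩ := hs.isCompact.isBounded.subset_closedBall 0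
    exact ⟨R, by simpa [Real.closedBall_eq_Icc] using hR⟩
  have hz : ∀ x, R < |x| → θ x = 0 := by
    intro x hx
    by_contra hne
    have := hR (subset_tsupport _ hne)
    exact absurd (abs_le.2 this) (not_le.2 hx)
  have hd : ∀ x, HasDerivAt (fun x => ∫ t in Iic x, θ t) (θ x) x := by
    intro x
    have e : (fun x => ∫ t in Iic x, θ t) = fun x => (∫ t in Iic 0, θ t) + ∫ t in (0:ℝ)..x, θ t := by
      funext y
      rw [intervalIntegral.integral_Iic_sub_Iic hint.integrableOn hint.integrableOn |>.symm]
      ring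
    rw [e]
    exact (intervalIntegral.integral_hasDerivAt_right (hθ.continuous.intervalIntegrable _ _)
      hθ.continuous.aestronglyMeasurable.stronglyMeasurableAtFilter
      hθ.continuous.continuousAt).const_add _
  have hder : deriv (fun x => ∫ t in Iic x, θ t) = θ := funext fun x => (hd x).deriv
  refine ⟨fun x => ∫ t in Iic x, θ t, ?_, ?_, hder⟩
  · refine contDiff_infty_iff_deriv.2 ⟨fun x => (hd x).differentiableAt, ?_⟩
    rw [hder]; exact hθ
  · refine HasCompactSupport.of_support_subset_isCompact (isCompact_Icc (a := -R) (b := R)) ?_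
    intro x hx
    by_contra hne
    have hx' : R < |x| := by
      by_contra hle
      exact hne (abs_le.1 (not_lt.1 hle))
    apply hx
    rcases lt_or_ge x 0 with hneg | hpos
    · refine setIntegral_eq_zero_of_forall_eq_zero fun t ht => hz t ?_
      rw [abs_of_neg hneg] at hx'
      rw [abs_of_neg (lt_of_le_of_lt ht hneg)]
      have : t ≤ x := ht
      linarith
    · have e : ∫ t in Ioi x, θ t = 0 := by
        refine setIntegral_eq_zero_of_forall_eq_zero fun t ht => hz t ?_
        have ht' : x < t := ht
        rw [abs_of_nonneg hpos] at hx'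
        rw [abs_of_nonneg (hpos.trans ht'.le)]
        linarith
      have := intervalIntegral.integral_Iic_add_Ioi (b := x) hint.integrableOn hint.integrableOn
      change ∫ t in Iic x, θ t = 0
      linarith

/-- The du Bois-Reymond lemma. -/
theorem ae_eq_const_of_integral_mul_deriv_eq_zero {h : ℝ → ℝ} (hl : LocallyIntegrable h)
    (h0 : ∀ χ : ℝ → ℝ, ContDiff ℝ ∞ χ → HasCompactSupport χ → ∫ x, h x * deriv χ x = 0) :
    ∃ k : ℝ, ∀ᵐ x, h x = k := by
  let ρ : ContDiffBump (0 : ℝ) := ⟨1, 2, one_pos, one_lt_two⟩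
  have hρ : ContDiff ℝ ∞ (ρ.normed volume) := ρ.contDiff_normed
  have hρs : HasCompactSupport (ρ.normed volume) := ρ.hasCompactSupport_normed
  have hρi : ∫ x, ρ.normed volume x = 1 := ρ.integral_normed
  have hi : ∀ {θ : ℝ → ℝ}, ContDiff ℝ ∞ θ → HasCompactSupport θ →
      Integrable (fun x => h x * θ x) := fun {θ} h1 h2 => by
    simpa [mul_comm] using hl.integrable_smul_left_of_hasCompactSupport h1.continuous h2
  set k := ∫ x, h x * ρ.normed volume x with hk
  refine ⟨k, ?_⟩
  have key := ae_eq_zero_of_integral_contDiff_smul_eq_zero (f := fun x => h x - k) (μ := volume)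
    (hl.sub (continuous_const.locallyIntegrable)) ?_
  · filter_upwards [key] with x hx
    exact sub_eq_zero.1 hx
  · intro θ h1 h2
    have hθi := h1.continuous.integrable_of_hasCompactSupport (μ := volume) h2
    have hρi' := hρ.continuous.integrable_of_hasCompactSupport (μ := volume) hρs
    -- Subtracting the multiple `∫ θ` of a bump of mass one leaves a function of integral zero,
    -- hence a derivative of a test function.
    obtain ⟨χ, c1, c2, c3⟩ := exists_compactSupport_primitive
      (θ := fun x => θ x - (∫ y, θ y) * ρ.normed volume x)
      (h1.sub (contDiff_const.mul hρ)) (h2.sub hρs.mul_left) (by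
        rw [integral_sub hθi (hρi'.const_mul _), integral_const_mul, hρi]; ring)
    have e := h0 χ c1 c2
    rw [c3] at e
    have e2 : ∫ x, h x * (θ x - (∫ y, θ y) * ρ.normed volume x)
        = (∫ x, h x * θ x) - (∫ y, θ y) * k := by
      rw [hk, ← integral_const_mul, ← integral_sub (hi h1 h2) ((hi hρ hρs).const_mul _)]
      congr 1; funext x; ring
    have e3 : ∫ x, θ x • (h x - k) = (∫ x, h x * θ x) - (∫ y, θ y) * k := by
      rw [← integral_mul_const, ← integral_sub (hi h1 h2) (hθi.mul_const _)]
      congr 1; funext x; simp only [smul_eq_mul]; ring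
    rw [e3, ← e2, e]

theorem h1Fun_memLp (u : H1) : MemLp (h1Fun u) 2 := Lp.memLp _

theorem h1Deriv_memLp (u : H1) : MemLp (h1Deriv u) 2 := Lp.memLp _

/-- An element of `H¹(ℝ)` has a representative that is an indefinite integral of its weak
derivative. -/
theorem exists_isIndefIntegral (u : H1) :
    ∃ f : ℝ → ℝ, IsIndefIntegral f (h1Deriv u) ∧ h1Fun u =ᵐ[volume] f := by
  have hl : LocallyIntegrable (h1Deriv u) := (h1Deriv_memLp u).locallyIntegrable (by norm_num)
  have hl' : LocallyIntegrable (h1Fun u) := (h1Fun_memLp u).locallyIntegrable (by norm_num)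
  let g : ℝ → ℝ := fun x => ∫ t in (0:ℝ)..x, h1Deriv u t
  have hg : IsIndefIntegral g (h1Deriv u) :=
    ⟨hl, fun x y => intervalIntegral.integral_interval_sub_left
      (hl.integrableOn_isCompact isCompact_uIcc).intervalIntegrable
      (hl.integrableOn_isCompact isCompact_uIcc).intervalIntegrable⟩
  obtain ⟨k, hk⟩ := ae_eq_const_of_integral_mul_deriv_eq_zero
    (h := fun x => h1Fun u x - g x) (hl'.sub hg.continuous.locallyIntegrable) (by
      intro χ c1 c2
      have hc := c1.continuous_deriv (n := ∞) (by simp)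
      have e1 := u.2 χ c1 c2
      have e2 := hg.integral_mul_deriv_eq_neg c1 c2
      have i1 : Integrable (fun x => h1Fun u x * deriv χ x) := by
        simpa [mul_comm] using hl'.integrable_smul_left_of_hasCompactSupport hc c2.deriv
      have i2 : Integrable (fun x => g x * deriv χ x) :=
        (hg.continuous.mul hc).integrable_of_hasCompactSupport c2.deriv.mul_left
      simp only [sub_mul]
      rw [integral_sub i1 i2, e2]
      change (∫ x, u.val.fst x * deriv χ x) - _ = 0
      rw [e1, h1Deriv]; ring)
  refine ⟨fun x => k + g x, ⟨hl, fun x y => ?_⟩, ?_⟩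
  · rw [← hg.sub_eq]; ring
  · filter_upwards [hk] with x hx
    linarith

/-- The element of `H¹(ℝ)` with a given square integrable representative and derivative. -/
def IsIndefIntegral.toH1 {F G : ℝ → ℝ} (h : IsIndefIntegral F G) (hF : MemLp F 2)
    (hG : MemLp G 2) : H1 :=
  ⟨WithLp.toLp 2 (hF.toLp F, hG.toLp G), by
    intro χ c1 c2
    have e1 : ∫ x, (hF.toLp F : Lp ℝ 2 (volume : Measure ℝ)) x * deriv χ x
        = ∫ x, F x * deriv χ x := by
      apply integral_congr_ae
      filter_upwards [hF.coeFn_toLp] with x hx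
      rw [hx]
    have e2 : ∫ x, (hG.toLp G : Lp ℝ 2 (volume : Measure ℝ)) x * χ x = ∫ x, G x * χ x := by
      apply integral_congr_ae
      filter_upwards [hG.coeFn_toLp] with x hx
      rw [hx]
    change ∫ x, (hF.toLp F : Lp ℝ 2 (volume : Measure ℝ)) x * deriv χ x
      = -∫ x, (hG.toLp G : Lp ℝ 2 (volume : Measure ℝ)) x * χ x
    rw [e1, e2, h.integral_mul_deriv_eq_neg c1 c2]⟩

namespace IsIndefIntegral

variable {F G : ℝ → ℝ} (h : IsIndefIntegral F G) (hF : MemLp F 2) (hG : MemLp G 2)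

theorem h1Fun_toH1 : h1Fun (h.toH1 hF hG) =ᵐ[volume] F := hF.coeFn_toLp

theorem h1Deriv_toH1 : h1Deriv (h.toH1 hF hG) =ᵐ[volume] G := hG.coeFn_toLp

end IsIndefIntegral

/-! ### The case of negative `b`. -/

/-- For `b < 0` the only weak solution is zero. -/
theorem IsWeakSolution.ae_eq_zero_of_neg {b c : ℝ} (hc : 0 < c) (hb : b < 0) {u : H1}
    (hu : IsWeakSolution b c u) : h1Fun u =ᵐ[volume] 0 := by
  -- With `φ = u` and `b < 0` each of the three terms of the weak equation is nonnegative.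
  have h := hu u
  have i1 : 0 ≤ ∫ x, (1 - b * h1Fun u x ^ 2) * h1Deriv u x * h1Deriv u x :=
    integral_nonneg fun x => by
      have e : (1 - b * h1Fun u x ^ 2) * h1Deriv u x * h1Deriv u x
        = (1 + (-b) * h1Fun u x ^ 2) * h1Deriv u x ^ 2 := by ring
      have hb' : 0 < -b := by linarith
      change 0 ≤ (1 - b * h1Fun u x ^ 2) * h1Deriv u x * h1Deriv u x
      rw [e]; positivity
  have i2 : 0 ≤ ∫ x, h1Fun u x * h1Deriv u x ^ 2 * h1Fun u x :=
    integral_nonneg fun x => by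
      have e : h1Fun u x * h1Deriv u x ^ 2 * h1Fun u x = (h1Fun u x * h1Deriv u x) ^ 2 := by ring
      change 0 ≤ h1Fun u x * h1Deriv u x ^ 2 * h1Fun u x
      rw [e]; positivity
  have i3 : 0 ≤ ∫ x, h1Fun u x * h1Fun u x := integral_nonneg fun x => mul_self_nonneg _
  have i4 : ∫ x, h1Fun u x * h1Fun u x = 0 := by
    have j2 := mul_nonneg (by linarith : 0 ≤ -(2 * b)) i2
    have j3 : c * (∫ x, h1Fun u x * h1Fun u x) ≤ 0 := by linarith
    exact le_antisymm (nonpos_of_mul_nonpos_right j3 hc) i3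
  rw [integral_eq_zero_iff_of_nonneg (fun x => mul_self_nonneg _)
    ((h1Fun_memLp u).integrable_mul (h1Fun_memLp u))] at i4
  filter_upwards [i4] with x hx
  simpa using hx

theorem not_isPositive_of_neg {b c : ℝ} (hc : 0 < c) (hb : b < 0) {u : H1}
    (hu : IsWeakSolution b c u) : ¬ IsPositive u := by
  rintro ⟨f, ⟨_, hf⟩, hpos⟩
  have h : ∀ᵐ _ : ℝ, False := by
    filter_upwards [hf, hu.ae_eq_zero_of_neg hc hb] with x h1 h2
    rw [h1] at h2
    exact (hpos x).ne' h2
  exact h.exists.elim fun _ => id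

/-! ### Derivatives of inverse functions, and Gaussian moments. -/

/-- A nonzero strict derivative makes `f` carry the neighbourhoods of `x` exactly onto those of `f
x`, so continuity of `g` can be tested after composing with `f`. It is needed because inverses
obtained by choice are not known to be continuous beforehand. -/
theorem HasStrictDerivAt.continuousAt_of_leftInvOn {f g : ℝ → ℝ} {f' x : ℝ} {I : Set ℝ}
    (h : HasStrictDerivAt f f' x) (h0 : f' ≠ 0) (hI : I ∈ 𝓝 x) (hg : ∀ y ∈ I, g (f y) = y) :
    ContinuousAt g (f x) := by
  rw [ContinuousAt, ← h.map_nhds_eq h0, hg x (mem_of_mem_nhds hI)]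
  refine tendsto_map'_iff.2 (tendsto_id.congr' ?_)
  filter_upwards [hI] with y hy
  exact (hg y hy).symm

/-- The derivative of a left inverse of a `C¹` function with nonvanishing derivative. -/
theorem hasDerivAt_of_leftInvOn {f f' g : ℝ → ℝ} {I : Set ℝ} (hI : IsOpen I)
    (hf : ∀ x ∈ I, HasDerivAt f (f' x) x) (hf' : ContinuousOn f' I) (h0 : ∀ x ∈ I, f' x ≠ 0)
    (hg : ∀ x ∈ I, g (f x) = x) {x : ℝ} (hx : x ∈ I) : HasDerivAt g (f' x)⁻¹ (f x) := by
  have hs : HasStrictDerivAt f (f' x) x :=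
    hasStrictDerivAt_of_hasDerivAt_of_continuousAt
      (by filter_upwards [hI.mem_nhds hx] with y hy using hf y hy)
      (hf'.continuousAt (hI.mem_nhds hx))
  have hc := hs.continuousAt_of_leftInvOn (h0 x hx) (hI.mem_nhds hx) hg
  have h1 : HasDerivAt f (f' x) (g (f x)) := by rw [hg x hx]; exact hf x hx
  refine h1.of_local_left_inverse hc (h0 x hx) ?_
  rw [← hs.map_nhds_eq (h0 x hx), eventually_map]
  filter_upwards [hI.mem_nhds hx] with y hy
  rw [hg y hy]

theorem integrable_pow_mul_exp_neg_sq_div_two (n : ℕ) :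
    Integrable fun s : ℝ => s ^ n * Real.exp (-s ^ 2 / 2) := by
  have h := integrable_rpow_mul_exp_neg_mul_sq (b := 1 / 2) (by norm_num) (s := n)
    (lt_of_lt_of_le (by norm_num) n.cast_nonneg)
  refine h.congr (Eventually.of_forall fun s => ?_)
  simp only [Real.rpow_natCast]
  congr 2; ring

theorem integrable_pow_mul_exp_neg_sq (n : ℕ) :
    Integrable fun s : ℝ => s ^ n * Real.exp (-s ^ 2) := by
  have h := integrable_rpow_mul_exp_neg_mul_sq (b := 1) (by norm_num) (s := n)
    (lt_of_lt_of_le (by norm_num) n.cast_nonneg)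
  refine h.congr (Eventually.of_forall fun s => ?_)
  simp only [Real.rpow_natCast]
  congr 2; ring

theorem integrable_exp_neg_sq : Integrable fun s : ℝ => Real.exp (-s ^ 2) := by
  simpa using integrable_pow_mul_exp_neg_sq 0

/-! ### The head in the slope coordinate. -/

/-- `|dx/dW|` on the head, as a function of the slope `W = -U'`, where `a = e^{2C}`. -/
def headKernel (a s : ℝ) : ℝ := a * Real.exp (-s ^ 2) / √(1 + a * Real.exp (-s ^ 2))

/-- The point of the head with slope `s`. -/
def headPos (a s : ℝ) : ℝ := ∫ t in (0 : ℝ)..s, headKernel a t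

/-- The half-width of the head. -/
def headLength (a : ℝ) : ℝ := ∫ t in Ioi (0 : ℝ), headKernel a t

/-- The slope of the head at a point. -/
def headSlope (a : ℝ) : ℝ → ℝ := Function.invFun (headPos a)

section Head

variable {a : ℝ}

theorem one_le_sqrt_head (ha : 0 ≤ a) (s : ℝ) : 1 ≤ √(1 + a * Real.exp (-s ^ 2)) := by
  rw [Real.one_le_sqrt]
  have : 0 ≤ a * Real.exp (-s ^ 2) := by positivity
  linarith

theorem headKernel_nonneg (ha : 0 ≤ a) (s : ℝ) : 0 ≤ headKernel a s := by
  unfold headKernel; positivity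

theorem headKernel_pos (ha : 0 < a) (s : ℝ) : 0 < headKernel a s := by
  unfold headKernel; positivity

theorem headKernel_le (ha : 0 ≤ a) (s : ℝ) : headKernel a s ≤ a * Real.exp (-s ^ 2) :=
  div_le_self (by positivity) (one_le_sqrt_head ha s)

theorem headKernel_neg (s : ℝ) : headKernel a (-s) = headKernel a s := by
  simp [headKernel]

theorem continuous_headKernel (ha : 0 ≤ a) : Continuous (headKernel a) := by
  unfold headKernel
  refine Continuous.div (by fun_prop) (by fun_prop) fun s => ?_
  have := one_le_sqrt_head ha s
  positivity

theorem integrable_headKernel (ha : 0 ≤ a) : Integrable (headKernel a) := by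
  refine (integrable_exp_neg_sq.const_mul a).mono'
    (continuous_headKernel ha).aestronglyMeasurable (Eventually.of_forall fun s => ?_)
  rw [Real.norm_of_nonneg (headKernel_nonneg ha s)]
  exact headKernel_le ha s

theorem headKernel_zero (s : ℝ) : headKernel 0 s = 0 := by simp [headKernel]

theorem headLength_zero : headLength 0 = 0 := by simp [headLength, headKernel_zero]

theorem headLength_nonneg (ha : 0 ≤ a) : 0 ≤ headLength a :=
  setIntegral_nonneg measurableSet_Ioi fun s _ => headKernel_nonneg ha s

theorem hasDerivAt_headPos (ha : 0 ≤ a) (s : ℝ) : HasDerivAt (headPos a) (headKernel a s) s :=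
  intervalIntegral.integral_hasDerivAt_right ((continuous_headKernel ha).intervalIntegrable _ _)
    (continuous_headKernel ha).aestronglyMeasurable.stronglyMeasurableAtFilter
    (continuous_headKernel ha).continuousAt

theorem continuous_headPos (ha : 0 ≤ a) : Continuous (headPos a) :=
  continuous_iff_continuousAt.2 fun s => (hasDerivAt_headPos ha s).continuousAt

theorem headPos_zero : headPos a 0 = 0 := by simp [headPos]

theorem headPos_neg (s : ℝ) : headPos a (-s) = -headPos a s := by
  have h := intervalIntegral.integral_comp_neg (a := 0) (b := s) (headKernel a)
  simp only [headKernel_neg, neg_zero] at h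
  rw [headPos, headPos, h, intervalIntegral.integral_symm]

theorem strictMono_headPos (ha : 0 < a) : StrictMono (headPos a) :=
  strictMono_of_deriv_pos fun s => by
    rw [(hasDerivAt_headPos ha.le s).deriv]; exact headKernel_pos ha s

theorem tendsto_headPos (ha : 0 ≤ a) : Tendsto (headPos a) atTop (𝓝 (headLength a)) :=
  intervalIntegral_tendsto_integral_Ioi 0 (integrable_headKernel ha).integrableOn tendsto_id

theorem headPos_lt (ha : 0 < a) (s : ℝ) : headPos a s < headLength a :=
  (strictMono_headPos ha (lt_add_one s)).trans_le
    ((strictMono_headPos ha).monotone.ge_of_tendsto (tendsto_headPos ha.le) _)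

theorem range_headPos (ha : 0 < a) : range (headPos a) = Ioo (-headLength a) (headLength a) := by
  ext y
  constructor
  · rintro ⟨s, rfl⟩
    refine ⟨?_, headPos_lt ha s⟩
    have := headPos_lt ha (-s)
    rw [headPos_neg] at this
    linarith
  · rintro ⟨h1, h2⟩
    obtain ⟨s1, hs1⟩ := ((tendsto_headPos ha.le).eventually_const_lt h2).exists
    obtain ⟨s2, hs2⟩ := ((tendsto_headPos ha.le).eventually_const_lt (neg_lt.1 h1)).exists
    refine mem_range_of_exists_le_of_exists_ge (continuous_headPos ha.le) ⟨-s2, ?_⟩ ⟨s1, hs1.le⟩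
    rw [headPos_neg]; linarith

theorem headLength_pos (ha : 0 < a) : 0 < headLength a := by
  simpa [headPos_zero] using headPos_lt ha 0

theorem headSlope_headPos (ha : 0 < a) (s : ℝ) : headSlope a (headPos a s) = s :=
  Function.leftInverse_invFun (strictMono_headPos ha).injective s

/-- For `a = 0` the head is empty. This lets later statements assume only `0 ≤ a`, so that the
cusped soliton needs no separate treatment. -/
theorem pos_of_abs_lt_headLength (ha : 0 ≤ a) {x : ℝ} (hx : |x| < headLength a) : 0 < a := by
  rcases ha.eq_or_lt with rfl | h
  · rw [headLength_zero] at hx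
    exact absurd hx (not_lt.2 (abs_nonneg x))
  · exact h

theorem headPos_headSlope (ha : 0 ≤ a) {x : ℝ} (hx : |x| < headLength a) :
    headPos a (headSlope a x) = x := by
  have ha' := pos_of_abs_lt_headLength ha hx
  refine Function.invFun_eq ?_
  have : x ∈ range (headPos a) := by rw [range_headPos ha']; exact abs_lt.1 hx
  exact this

theorem headSlope_neg (ha : 0 ≤ a) {x : ℝ} (hx : |x| < headLength a) :
    headSlope a (-x) = -headSlope a x := by
  have ha' := pos_of_abs_lt_headLength ha hx
  apply (strictMono_headPos ha').injective
  rw [headPos_neg, headPos_headSlope ha hx, headPos_headSlope ha (by rwa [abs_neg])]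

theorem lt_headSlope_iff (ha : 0 ≤ a) {x s : ℝ} (hx : |x| < headLength a) :
    s < headSlope a x ↔ headPos a s < x := by
  rw [← (strictMono_headPos (pos_of_abs_lt_headLength ha hx)).lt_iff_lt, headPos_headSlope ha hx]

theorem headSlope_lt_iff (ha : 0 ≤ a) {x s : ℝ} (hx : |x| < headLength a) :
    headSlope a x < s ↔ x < headPos a s := by
  rw [← (strictMono_headPos (pos_of_abs_lt_headLength ha hx)).lt_iff_lt, headPos_headSlope ha hx]

theorem hasDerivAt_headSlope (ha : 0 ≤ a) {x : ℝ} (hx : |x| < headLength a) :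
    HasDerivAt (headSlope a) (headKernel a (headSlope a x))⁻¹ x := by
  have ha' := pos_of_abs_lt_headLength ha hx
  have h := hasDerivAt_of_leftInvOn (g := headSlope a) isOpen_univ
    (fun s _ => hasDerivAt_headPos ha s) (continuous_headKernel ha).continuousOn
    (fun s _ => (headKernel_pos ha' s).ne') (fun s _ => headSlope_headPos ha' s)
    (mem_univ (headSlope a x))
  rwa [headPos_headSlope ha hx] at h

end Head

/-! ### The tail in the slope coordinate. -/

/-- `|dx/dW|` on the tail, as a function of the slope. -/
def tailKernel (s : ℝ) : ℝ := Real.exp (-s ^ 2) / √(1 - Real.exp (-s ^ 2))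

/-- The distance from the cusp at which the tail has slope `s`. -/
def tailPos (s : ℝ) : ℝ := ∫ t in Ioi s, tailKernel t

/-- The slope of the tail at a given distance from the cusp. -/
def tailSlope : ℝ → ℝ := Function.invFunOn tailPos (Ioi 0)

section Tail

theorem one_sub_exp_pos {s : ℝ} (hs : s ≠ 0) : 0 < 1 - Real.exp (-s ^ 2) := by
  have : 0 < s ^ 2 := by positivity
  have : Real.exp (-s ^ 2) < 1 := by
    rw [← Real.exp_zero, Real.exp_lt_exp]; linarith
  linarith

theorem one_sub_exp_le (s : ℝ) : 1 - Real.exp (-s ^ 2) ≤ s ^ 2 := by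
  have := Real.add_one_le_exp (-s ^ 2)
  linarith

theorem tailKernel_pos {s : ℝ} (hs : s ≠ 0) : 0 < tailKernel s :=
  div_pos (Real.exp_pos _) (Real.sqrt_pos.2 (one_sub_exp_pos hs))

/-- Follows from `1 - e^{-s²} ≥ s² e^{-s²}`, that is, `e^{s²} ≥ 1 + s²`. The kernel has only a `1/s`
singularity at `0`, so one factor `s` makes it integrable. -/
theorem tailKernel_le {s : ℝ} (hs : 0 < s) : tailKernel s ≤ Real.exp (-s ^ 2 / 2) / s := by
  have h1 : s * Real.exp (-s ^ 2 / 2) ≤ √(1 - Real.exp (-s ^ 2)) := by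
    apply Real.le_sqrt_of_sq_le
    have e : (s * Real.exp (-s ^ 2 / 2)) ^ 2 = s ^ 2 * Real.exp (-s ^ 2) := by
      rw [mul_pow, ← Real.exp_nat_mul]; congr 2; push_cast; ring
    have h := Real.add_one_le_exp (s ^ 2)
    have h2 : Real.exp (s ^ 2) * Real.exp (-s ^ 2) = 1 := by rw [← Real.exp_add]; simp
    have := Real.exp_pos (-s ^ 2)
    rw [e]
    nlinarith
  have e : Real.exp (-s ^ 2) = Real.exp (-s ^ 2 / 2) * Real.exp (-s ^ 2 / 2) := by
    rw [← Real.exp_add]; congr 1; ring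
  rw [tailKernel, div_le_div_iff₀ (Real.sqrt_pos.2 (one_sub_exp_pos hs.ne')) hs]
  calc Real.exp (-s ^ 2) * s = Real.exp (-s ^ 2 / 2) * (s * Real.exp (-s ^ 2 / 2)) := by
        rw [e]; ring
    _ ≤ _ := by gcongr

/-- The matching lower bound: the `1/s` singularity is genuine, which is why the tail reaches to
infinity. -/
theorem le_tailKernel {s : ℝ} (hs : 0 < s) : Real.exp (-s ^ 2) / s ≤ tailKernel s := by
  have h1 : √(1 - Real.exp (-s ^ 2)) ≤ s := Real.sqrt_le_iff.2 ⟨hs.le, one_sub_exp_le s⟩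
  exact div_le_div_of_nonneg_left (Real.exp_pos _).le
    (Real.sqrt_pos.2 (one_sub_exp_pos hs.ne')) h1

theorem continuousOn_tailKernel : ContinuousOn tailKernel (Ioi 0) := by
  unfold tailKernel
  exact ContinuousOn.div (by fun_prop) (by fun_prop) fun s hs =>
    (Real.sqrt_pos.2 (one_sub_exp_pos (ne_of_gt hs))).ne'

theorem integrableOn_pow_mul_tailKernel (n : ℕ) :
    IntegrableOn (fun s => s ^ (n + 1) * tailKernel s) (Ioi 0) := by
  refine (integrable_pow_mul_exp_neg_sq_div_two n).integrableOn.mono'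
    (((continuous_pow (n + 1)).continuousOn.mul continuousOn_tailKernel).aestronglyMeasurable
      measurableSet_Ioi)
    ((ae_restrict_mem measurableSet_Ioi).mono fun s hs => ?_)
  have hs : 0 < s := hs
  rw [Real.norm_of_nonneg (mul_nonneg (by positivity) (tailKernel_pos hs.ne').le)]
  calc s ^ (n + 1) * tailKernel s ≤ s ^ (n + 1) * (Real.exp (-s ^ 2 / 2) / s) := by
        gcongr; exact tailKernel_le hs
    _ = s ^ n * Real.exp (-s ^ 2 / 2) := by
      field_simp; ring

theorem integrableOn_tailKernel {s : ℝ} (hs : 0 < s) : IntegrableOn tailKernel (Ioi s) := by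
  have h := (integrableOn_pow_mul_tailKernel 0).mono_set (Ioi_subset_Ioi hs.le)
  refine (h.const_mul s⁻¹).mono'
    ((continuousOn_tailKernel.mono (Ioi_subset_Ioi hs.le)).aestronglyMeasurable measurableSet_Ioi)
    ((ae_restrict_mem measurableSet_Ioi).mono fun t ht => ?_)
  have ht : s < t := ht
  have hk := (tailKernel_pos (hs.trans ht).ne').le
  rw [Real.norm_of_nonneg hk, zero_add, pow_one, ← mul_assoc]
  refine le_mul_of_one_le_left hk ?_
  rw [inv_mul_eq_div, one_le_div hs]
  exact ht.le

theorem tailPos_sub {s t : ℝ} (hs : 0 < s) (ht : 0 < t) :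
    tailPos s - tailPos t = ∫ r in s..t, tailKernel r :=
  intervalIntegral.integral_Ioi_sub_Ioi' (integrableOn_tailKernel hs) (integrableOn_tailKernel ht)

theorem hasDerivAt_tailPos {s : ℝ} (hs : 0 < s) : HasDerivAt tailPos (-tailKernel s) s := by
  have h : HasDerivAt (fun t => tailPos s - ∫ r in s..t, tailKernel r) (-tailKernel s) s := by
    refine HasDerivAt.const_sub _ ?_
    refine intervalIntegral.integral_hasDerivAt_right (by simp) ?_
      (continuousOn_tailKernel.continuousAt (Ioi_mem_nhds hs))
    exact continuousOn_tailKernel.stronglyMeasurableAtFilter isOpen_Ioi s hs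
  refine h.congr_of_eventuallyEq ?_
  filter_upwards [Ioi_mem_nhds hs] with t ht
  rw [← tailPos_sub hs ht]; ring

theorem continuousOn_tailPos : ContinuousOn tailPos (Ioi 0) := fun _ hs =>
  (hasDerivAt_tailPos hs).continuousAt.continuousWithinAt

theorem strictAntiOn_tailPos : StrictAntiOn tailPos (Ioi 0) := by
  refine strictAntiOn_of_deriv_neg (convex_Ioi 0) continuousOn_tailPos fun _ hs => ?_
  rw [interior_Ioi] at hs
  rw [(hasDerivAt_tailPos hs).deriv]
  exact neg_neg_of_pos (tailKernel_pos (ne_of_gt hs))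

theorem tailPos_nonneg {s : ℝ} (hs : 0 < s) : 0 ≤ tailPos s :=
  setIntegral_nonneg measurableSet_Ioi fun _ ht => (tailKernel_pos (hs.trans ht).ne').le

theorem tailPos_pos {s : ℝ} (hs : 0 < s) : 0 < tailPos s :=
  (tailPos_nonneg (by linarith : 0 < s + 1)).trans_lt
    (strictAntiOn_tailPos hs (by simp; linarith) (lt_add_one s))

theorem tendsto_tailPos : Tendsto tailPos atTop (𝓝 0) := by
  have h := intervalIntegral_tendsto_integral_Ioi 1 (integrableOn_tailKernel one_pos) tendsto_id
  have h2 := h.const_sub (tailPos 1)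
  rw [show tailPos 1 - ∫ x in Ioi 1, tailKernel x = 0 from sub_self _] at h2
  refine h2.congr' ?_
  filter_upwards [eventually_gt_atTop 0] with s hs
  rw [id, ← tailPos_sub one_pos hs]; ring

theorem exists_le_tailPos (y : ℝ) : ∃ s, 0 < s ∧ y ≤ tailPos s := by
  -- On `(0, 1]` the kernel is at least `e⁻¹ / r`, whose integral over `[s, 1]` is `e⁻¹ log (1/s)`;
  -- this `s` makes it equal to `|y|`.
  set s := Real.exp (-(Real.exp 1 * |y|)) with hs
  have hs0 : 0 < s := Real.exp_pos _
  have hs1 : s ≤ 1 := Real.exp_le_one_iff.2 (by simp; positivity)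
  refine ⟨s, hs0, ?_⟩
  have h1 : ∫ r in s..1, Real.exp (-1) * r⁻¹ ≤ ∫ r in s..1, tailKernel r := by
    refine intervalIntegral.integral_mono_on hs1 ?_ ?_ fun r hr => ?_
    · refine ContinuousOn.intervalIntegrable_of_Icc hs1 ?_
      exact continuousOn_const.mul (continuousOn_id.inv₀ fun r hr => (hs0.trans_le hr.1).ne')
    · exact (continuousOn_tailKernel.mono fun r hr => hs0.trans_le hr.1).intervalIntegrable_of_Icc
        hs1
    · have hr0 := hs0.trans_le hr.1
      refine le_trans ?_ (le_tailKernel hr0)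
      rw [div_eq_mul_inv]
      gcongr
      nlinarith [hr.2]
  rw [intervalIntegral.integral_const_mul, integral_inv_of_pos hs0 one_pos, one_div, Real.log_inv,
    ← tailPos_sub hs0 one_pos, hs, Real.log_exp, neg_neg, ← mul_assoc, ← Real.exp_add] at h1
  have := tailPos_nonneg one_pos
  have := le_abs_self y
  simp only [neg_add_cancel, Real.exp_zero, one_mul] at h1
  linarith

theorem image_tailPos : tailPos '' Ioi 0 = Ioi 0 := by
  ext y
  constructor
  · rintro ⟨s, hs, rfl⟩
    exact tailPos_pos hs
  · intro hy
    obtain ⟨s, hs, hys⟩ := exists_le_tailPos y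
    obtain ⟨t, ht, hty⟩ := ((eventually_gt_atTop (0 : ℝ)).and
      (tendsto_tailPos.eventually_lt_const hy)).exists
    obtain ⟨r, hr, e⟩ := isPreconnected_Ioi.intermediate_value ht hs continuousOn_tailPos
      ⟨hty.le, hys⟩
    exact ⟨r, hr, e⟩

theorem tailSlope_tailPos {s : ℝ} (hs : 0 < s) : tailSlope (tailPos s) = s :=
  strictAntiOn_tailPos.injOn.leftInvOn_invFunOn hs

theorem tailSlope_pos {y : ℝ} (hy : 0 < y) : 0 < tailSlope y :=
  Function.invFunOn_mem (s := Ioi 0) (f := tailPos) (by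
    have : y ∈ tailPos '' Ioi 0 := by rw [image_tailPos]; exact hy
    exact this)

theorem tailPos_tailSlope {y : ℝ} (hy : 0 < y) : tailPos (tailSlope y) = y :=
  Function.invFunOn_eq (s := Ioi 0) (f := tailPos) (by
    have : y ∈ tailPos '' Ioi 0 := by rw [image_tailPos]; exact hy
    exact this)

theorem lt_tailSlope_iff {y s : ℝ} (hy : 0 < y) (hs : 0 < s) :
    s < tailSlope y ↔ y < tailPos s := by
  rw [← strictAntiOn_tailPos.lt_iff_gt (tailSlope_pos hy) hs, tailPos_tailSlope hy]

theorem hasDerivAt_tailSlope {y : ℝ} (hy : 0 < y) :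
    HasDerivAt tailSlope (-tailKernel (tailSlope y))⁻¹ y := by
  have h := hasDerivAt_of_leftInvOn (g := tailSlope) isOpen_Ioi
    (fun _ hs => hasDerivAt_tailPos hs) continuousOn_tailKernel.neg
    (fun _ hs => (neg_neg_of_pos (tailKernel_pos (ne_of_gt hs))).ne)
    (fun s hs => tailSlope_tailPos hs) (tailSlope_pos hy)
  rwa [tailPos_tailSlope hy] at h

end Tail

/-! ### The solitons glued from head and tail. -/

/-- The negative derivative `-U'` of the soliton with parameter `a = e^{2C}`, for `b = c = 1`. -/
def waveSlope (a x : ℝ) : ℝ :=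
  -- At `|x| = headLength a` the slope is infinite and the value given here is a default. It is
  -- harmless: `excess` is `0` there, and the points form a null set.
  if |x| < headLength a then headSlope a x else Real.sign x * tailSlope (|x| - headLength a)

/-- The function `U² - 1` of the soliton with parameter `a = e^{2C}`, for `b = c = 1`. -/
def excess (a x : ℝ) : ℝ :=
  if |x| < headLength a then a * Real.exp (-headSlope a x ^ 2)
  else if |x| = headLength a then 0 else -Real.exp (-tailSlope (|x| - headLength a) ^ 2)

/-- The soliton with parameter `a = e^{2C}`, for `b = c = 1`. -/
def profile (a x : ℝ) : ℝ := √(1 + excess a x)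

section Profile

variable {a x : ℝ}

theorem waveSlope_of_lt (hx : |x| < headLength a) : waveSlope a x = headSlope a x := if_pos hx

theorem waveSlope_of_gt (hx : headLength a < |x|) :
    waveSlope a x = Real.sign x * tailSlope (|x| - headLength a) := if_neg hx.not_gt

theorem waveSlope_sq_of_gt (ha : 0 ≤ a) (hx : headLength a < |x|) :
    waveSlope a x ^ 2 = tailSlope (|x| - headLength a) ^ 2 := by
  have h0 : x ≠ 0 := abs_pos.1 ((headLength_nonneg ha).trans_lt hx)
  rw [waveSlope_of_gt hx, mul_pow]
  rcases Real.sign_apply_eq_of_ne_zero x h0 with h | h <;> simp [h]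

theorem excess_of_lt (hx : |x| < headLength a) :
    excess a x = a * Real.exp (-waveSlope a x ^ 2) := by
  rw [waveSlope_of_lt hx, excess, if_pos hx]

theorem excess_of_eq (hx : |x| = headLength a) : excess a x = 0 := by simp [excess, hx]

theorem excess_of_gt (ha : 0 ≤ a) (hx : headLength a < |x|) :
    excess a x = -Real.exp (-waveSlope a x ^ 2) := by
  rw [waveSlope_sq_of_gt ha hx, excess, if_neg hx.not_gt, if_neg hx.ne']

theorem waveSlope_neg (ha : 0 ≤ a) (x : ℝ) : waveSlope a (-x) = -waveSlope a x := by
  unfold waveSlope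
  rw [abs_neg]
  split_ifs with h
  · exact headSlope_neg ha h
  · rw [Real.sign_neg, neg_mul]

theorem excess_neg (ha : 0 ≤ a) (x : ℝ) : excess a (-x) = excess a x := by
  unfold excess
  rw [abs_neg]
  split_ifs with h
  · rw [headSlope_neg ha h, neg_sq]
  · rfl
  · rfl

theorem profile_neg (ha : 0 ≤ a) (x : ℝ) : profile a (-x) = profile a x := by
  rw [profile, excess_neg ha, profile]

theorem profile_abs (ha : 0 ≤ a) (x : ℝ) : profile a |x| = profile a x := by
  rcases abs_choice x with h | h <;> rw [h]
  exact profile_neg ha x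

theorem waveSlope_pos (ha : 0 ≤ a) (hx : 0 < x) (hne : x ≠ headLength a) : 0 < waveSlope a x := by
  have habs := abs_of_pos hx
  rcases lt_or_gt_of_ne hne with h | h
  · rw [← habs] at h
    rwa [waveSlope_of_lt h, lt_headSlope_iff ha h, headPos_zero]
  · rw [waveSlope_of_gt (by rwa [habs]), Real.sign_of_pos hx, one_mul, habs]
    exact tailSlope_pos (sub_pos.2 h)

theorem excess_pos (ha : 0 ≤ a) (hx : |x| < headLength a) : 0 < excess a x := by
  rw [excess_of_lt hx]
  have := pos_of_abs_lt_headLength ha hx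
  positivity

theorem excess_le (ha : 0 ≤ a) (hx : |x| ≤ headLength a) : excess a x ≤ a := by
  rcases hx.lt_or_eq with h | h
  · rw [excess_of_lt h]
    exact mul_le_of_le_one_right ha (Real.exp_le_one_iff.2 (by nlinarith [sq_nonneg (waveSlope a x)]))
  · rwa [excess_of_eq h]

theorem excess_nonneg (ha : 0 ≤ a) (hx : |x| ≤ headLength a) : 0 ≤ excess a x := by
  rcases hx.lt_or_eq with h | h
  · exact (excess_pos ha h).le
  · rw [excess_of_eq h]

theorem excess_neg_of_gt (ha : 0 ≤ a) (hx : headLength a < |x|) : excess a x < 0 := by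
  rw [excess_of_gt ha hx]
  exact neg_neg_of_pos (Real.exp_pos _)

theorem excess_ne_zero (ha : 0 ≤ a) (hx : |x| ≠ headLength a) : excess a x ≠ 0 := by
  rcases lt_or_gt_of_ne hx with h | h
  · exact (excess_pos ha h).ne'
  · exact (excess_neg_of_gt ha h).ne

theorem one_add_excess_pos (ha : 0 ≤ a) (x : ℝ) : 0 < 1 + excess a x := by
  rcases lt_or_ge (headLength a) |x| with h | h
  · rw [excess_of_gt ha h, waveSlope_sq_of_gt ha h]
    have := one_sub_exp_pos (tailSlope_pos (sub_pos.2 h)).ne'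
    linarith
  · linarith [excess_nonneg ha h]

theorem profile_pos (ha : 0 ≤ a) (x : ℝ) : 0 < profile a x :=
  Real.sqrt_pos.2 (one_add_excess_pos ha x)

theorem profile_sq (ha : 0 ≤ a) (x : ℝ) : profile a x ^ 2 = 1 + excess a x :=
  Real.sq_sqrt (one_add_excess_pos ha x).le

theorem one_le_profile (ha : 0 ≤ a) (hx : |x| ≤ headLength a) : 1 ≤ profile a x := by
  rw [profile, Real.one_le_sqrt]
  linarith [excess_nonneg ha hx]

theorem profile_le_of_le (ha : 0 ≤ a) (hx : |x| ≤ headLength a) : profile a x ≤ √(1 + a) :=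
  Real.sqrt_le_sqrt (by linarith [excess_le ha hx])

theorem profile_le_one (ha : 0 ≤ a) (hx : headLength a ≤ |x|) : profile a x ≤ 1 := by
  rw [profile, Real.sqrt_le_one]
  rcases hx.lt_or_eq with h | h
  · linarith [excess_neg_of_gt ha h]
  · rw [excess_of_eq h.symm]; simp

theorem profile_of_eq (hx : |x| = headLength a) : profile a x = 1 := by
  simp [profile, excess_of_eq hx]

theorem profile_zero (ha : 0 ≤ a) : profile a 0 = √(1 + a) := by
  rcases ha.eq_or_lt with rfl | h
  · rw [profile_of_eq (by rw [headLength_zero, abs_zero])]; simp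
  · have h0 : |(0 : ℝ)| < headLength a := by simpa using headLength_pos h
    rw [profile, excess_of_lt h0, waveSlope_of_lt h0]
    have : headSlope a 0 = 0 := by
      have := headSlope_headPos h 0
      rwa [headPos_zero] at this
    simp [this]

theorem profile_eq_profile_zero (ha : 0 ≤ a) (hx : headLength a < |x|) :
    profile a x = profile 0 (|x| - headLength a) := by
  have h1 : |(|x| - headLength a)| = |x| - headLength a := abs_of_pos (sub_pos.2 hx)
  have h2 : headLength 0 < |(|x| - headLength a)| := by
    rw [headLength_zero, h1]; exact sub_pos.2 hx
  rw [profile, profile, excess_of_gt ha hx, excess_of_gt le_rfl h2, waveSlope_sq_of_gt ha hx,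
    waveSlope_sq_of_gt le_rfl h2, h1, headLength_zero, sub_zero]

theorem hasDerivAt_waveSlope_of_pos_gt (ha : 0 ≤ a) (hx : headLength a < x) :
    HasDerivAt (waveSlope a) (profile a x / excess a x) x := by
  have h0 : 0 < x := (headLength_nonneg ha).trans_lt hx
  have hx' : headLength a < |x| := by rwa [abs_of_pos h0]
  have h := (hasDerivAt_tailSlope (sub_pos.2 hx)).comp x ((hasDerivAt_id x).sub_const (headLength a))
  have e : profile a x / excess a x = (-tailKernel (tailSlope (x - headLength a)))⁻¹ * 1 := by
    rw [profile, excess_of_gt ha hx', waveSlope_sq_of_gt ha hx', abs_of_pos h0, tailKernel, mul_one,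
      ← neg_div, inv_div, ← sub_eq_add_neg]
  rw [e]
  refine h.congr_of_eventuallyEq ?_
  filter_upwards [lt_mem_nhds hx] with y hy
  have hy0 : 0 < y := (headLength_nonneg ha).trans_lt hy
  rw [waveSlope_of_gt (by rwa [abs_of_pos hy0]), Real.sign_of_pos hy0, one_mul, abs_of_pos hy0]
  rfl

/-- Both kernels equal `|U² - 1| / U`, so inverting them gives one differential equation `W' = U /
(U² - 1)` on head and tail. Oddness of `W` transfers it to the negative tail. -/
theorem hasDerivAt_waveSlope (ha : 0 ≤ a) (hx : |x| ≠ headLength a) :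
    HasDerivAt (waveSlope a) (profile a x / excess a x) x := by
  rcases lt_or_gt_of_ne hx with h | h
  · have h1 := hasDerivAt_headSlope ha h
    have e : profile a x / excess a x = (headKernel a (headSlope a x))⁻¹ := by
      rw [profile, excess_of_lt h, waveSlope_of_lt h, headKernel, inv_div]
    rw [e]
    refine h1.congr_of_eventuallyEq ?_
    filter_upwards [continuous_abs.continuousAt.eventually_lt_const h] with y hy
    exact waveSlope_of_lt hy
  · rcases le_or_gt 0 x with h0 | h0
    · exact hasDerivAt_waveSlope_of_pos_gt ha (by rwa [abs_of_nonneg h0] at h)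
    · rw [abs_of_neg h0] at h
      have h1 := (hasDerivAt_waveSlope_of_pos_gt ha h).comp x (hasDerivAt_neg x)
      rw [profile_neg ha, excess_neg ha] at h1
      have h2 := h1.neg
      refine (h2.congr_of_eventuallyEq (Eventually.of_forall fun y => ?_)).congr_deriv (by ring)
      simp [waveSlope_neg ha]

/-- Locally `excess` is a constant (`a` or `-1`) times `e^{-W²}`, so differentiating reproduces the
factor `excess`, which cancels the denominator of `W'`. -/
theorem hasDerivAt_excess (ha : 0 ≤ a) (hx : |x| ≠ headLength a) :
    HasDerivAt (excess a) (-2 * waveSlope a x * profile a x) x := by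
  have hE := excess_ne_zero ha hx
  have hW : HasDerivAt (fun y => Real.exp (-waveSlope a y ^ 2))
      (Real.exp (-waveSlope a x ^ 2) * -(2 * waveSlope a x * (profile a x / excess a x))) x := by
    simpa using ((hasDerivAt_waveSlope ha hx).fun_pow 2).fun_neg.exp
  rcases lt_or_gt_of_ne hx with h | h
  · refine ((hW.const_mul a).congr_of_eventuallyEq ?_).congr_deriv ?_
    · filter_upwards [continuous_abs.continuousAt.eventually_lt_const h] with y hy
      exact excess_of_lt hy
    · have ha' := (pos_of_abs_lt_headLength ha h).ne'
      rw [excess_of_lt h] at hE ⊢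
      field_simp
  · refine (hW.neg.congr_of_eventuallyEq ?_).congr_deriv ?_
    · filter_upwards [continuous_abs.continuousAt.eventually_const_lt h] with y hy
      exact excess_of_gt ha hy
    · rw [excess_of_gt ha h] at hE ⊢
      field_simp

theorem hasDerivAt_profile (ha : 0 ≤ a) (hx : |x| ≠ headLength a) :
    HasDerivAt (profile a) (-waveSlope a x) x := by
  have h := ((hasDerivAt_excess ha hx).const_add 1).sqrt (one_add_excess_pos ha x).ne'
  refine h.congr_deriv ?_
  change -2 * waveSlope a x * profile a x / (2 * profile a x) = _
  have := profile_pos ha x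
  field_simp

/-- The derivative of `(1 - U²) U'`. -/
theorem hasDerivAt_excess_mul_waveSlope (ha : 0 ≤ a) (hx : |x| ≠ headLength a) :
    HasDerivAt (fun y => excess a y * waveSlope a y)
      (profile a x - 2 * (profile a x * waveSlope a x ^ 2)) x := by
  refine ((hasDerivAt_excess ha hx).mul (hasDerivAt_waveSlope ha hx)).congr_deriv ?_
  rw [mul_div_cancel₀ _ (excess_ne_zero ha hx)]
  ring

/-- The slope exceeds `M` in absolute value once `|y|` lies between `headPos a M` and `headLength a
+ tailPos M`, the meeting point itself excepted. If `a = 0` there is no constraint from the head. -/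
theorem eventually_lt_abs_waveSlope (ha : 0 ≤ a) (hx : |x| = headLength a) {M : ℝ} (hM : 0 < M) :
    ∀ᶠ y in 𝓝 x, |y| ≠ headLength a → M < |waveSlope a y| := by
  have h1 : ∀ᶠ y in 𝓝 x, |y| < headLength a + tailPos M :=
    continuous_abs.continuousAt.eventually_lt_const (by rw [hx]; linarith [tailPos_pos hM])
  have h2 : ∀ᶠ y in 𝓝 x, 0 < a → headPos a M < |y| := by
    rcases ha.eq_or_lt with h | h
    · exact Eventually.of_forall fun y hy => absurd hy h.not_lt
    · filter_upwards [continuous_abs.continuousAt.eventually_const_lt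
        (show headPos a M < |x| by rw [hx]; exact headPos_lt h M)] with y hy _
      exact hy
  have habs : ∀ y, |waveSlope a y| = |waveSlope a (|y|)| := by
    intro y
    rcases abs_choice y with h | h <;> rw [h]
    rw [waveSlope_neg ha, abs_neg]
  filter_upwards [h1, h2] with y hy1 hy2 hne
  rw [habs]
  refine lt_of_lt_of_le ?_ (le_abs_self _)
  rcases lt_or_gt_of_ne hne with h | h
  · have h' : |(|y|)| < headLength a := by rwa [abs_abs]
    rw [waveSlope_of_lt h', lt_headSlope_iff ha h']
    exact hy2 (pos_of_abs_lt_headLength ha h)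
  · have hy0 : 0 < |y| := (headLength_nonneg ha).trans_lt h
    rw [waveSlope_of_gt (by rwa [abs_abs]), Real.sign_of_pos hy0, one_mul, abs_abs,
      lt_tailSlope_iff (sub_pos.2 h) hM]
    linarith

theorem abs_excess_le (ha : 0 ≤ a) (x : ℝ) :
    |excess a x| ≤ (a + 1) * Real.exp (-waveSlope a x ^ 2) := by
  have he := Real.exp_pos (-waveSlope a x ^ 2)
  rcases lt_trichotomy |x| (headLength a) with h | h | h
  · rw [abs_of_pos (excess_pos ha h), excess_of_lt h]
    nlinarith
  · rw [excess_of_eq h, abs_zero]; positivity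
  · rw [excess_of_gt ha h, abs_neg, abs_of_pos he]
    nlinarith

/-- `|U² - 1|` is of size `e^{-W²}` and `|W|` tends to infinity, so the Gaussian beats the linear
factor. The factor `1 + |W|` serves the continuity of `excess` and of the flux at once. -/
theorem tendsto_excess_mul (ha : 0 ≤ a) (hx : |x| = headLength a) :
    Tendsto (fun y => |excess a y| * (1 + |waveSlope a y|)) (𝓝 x) (𝓝 0) := by
  rw [Metric.tendsto_nhds]
  intro ε hε
  -- With `e^{-w²} ≤ 1 / (1 + w²)` and `(1 + w) w ≤ 2 (1 + w²)` the quantity is at most `2 (a + 1) /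
  -- w`, hence the second threshold.
  have hM : 0 < max 1 (2 * (a + 1) / ε) := by positivity
  filter_upwards [eventually_lt_abs_waveSlope ha hx hM] with y hy
  rw [Real.dist_eq, sub_zero, abs_of_nonneg (by positivity)]
  by_cases h : |y| = headLength a
  · rw [excess_of_eq h]; simpa using hε
  · have h1 := hy h
    set w := |waveSlope a y|
    have hw1 : 1 < w := (le_max_left _ _).trans_lt h1
    have hw2 : 2 * (a + 1) / ε < w := (le_max_right _ _).trans_lt h1
    have he : Real.exp (-waveSlope a y ^ 2) ≤ (1 + w ^ 2)⁻¹ := by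
      rw [Real.exp_neg, ← sq_abs]
      have := Real.add_one_le_exp (w ^ 2)
      gcongr
      linarith
    calc |excess a y| * (1 + w) ≤ ((a + 1) * (1 + w ^ 2)⁻¹) * (1 + w) := by
          refine mul_le_mul_of_nonneg_right ((abs_excess_le ha y).trans ?_) (by positivity)
          gcongr
      _ ≤ 2 * (a + 1) / w := by
          rw [le_div_iff₀ (by positivity)]
          rw [show (a + 1) * (1 + w ^ 2)⁻¹ * (1 + w) * w = (a + 1) * ((1 + w) * w) / (1 + w ^ 2) by
            field_simp, div_le_iff₀ (by positivity)]
          nlinarith [mul_nonneg (by positivity : 0 ≤ a + 1) (by nlinarith : 0 ≤ 2 + w ^ 2 - w)]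
      _ < ε := by
          rw [div_lt_iff₀ (by positivity)]
          rw [div_lt_iff₀ hε] at hw2
          linarith

theorem continuous_excess (ha : 0 ≤ a) : Continuous (excess a) := by
  refine continuous_iff_continuousAt.2 fun x => ?_
  by_cases hx : |x| = headLength a
  · rw [ContinuousAt, excess_of_eq hx]
    refine squeeze_zero_norm (fun y => ?_) (tendsto_excess_mul ha hx)
    rw [Real.norm_eq_abs]
    exact le_mul_of_one_le_right (abs_nonneg _) (by linarith [abs_nonneg (waveSlope a y)])
  · exact (hasDerivAt_excess ha hx).continuousAt

theorem continuous_excess_mul_waveSlope (ha : 0 ≤ a) :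
    Continuous fun x => excess a x * waveSlope a x := by
  refine continuous_iff_continuousAt.2 fun x => ?_
  by_cases hx : |x| = headLength a
  · rw [ContinuousAt, excess_of_eq hx, zero_mul]
    refine squeeze_zero_norm (fun y => ?_) (tendsto_excess_mul ha hx)
    rw [Real.norm_eq_abs, abs_mul]
    gcongr
    linarith
  · exact (hasDerivAt_excess_mul_waveSlope ha hx).continuousAt

theorem continuous_profile (ha : 0 ≤ a) : Continuous (profile a) :=
  ((continuous_excess ha).const_add 1).sqrt

theorem strictAntiOn_profile (ha : 0 ≤ a) : StrictAntiOn (profile a) (Ici 0) := by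
  have hl := headLength_nonneg ha
  have h1 : StrictAntiOn (profile a) (Icc 0 (headLength a)) := by
    refine strictAntiOn_of_deriv_neg (convex_Icc _ _) (continuous_profile ha).continuousOn
      fun x hx => ?_
    rw [interior_Icc] at hx
    rw [(hasDerivAt_profile ha (by rw [abs_of_pos hx.1]; exact hx.2.ne)).deriv]
    exact neg_neg_of_pos (waveSlope_pos ha hx.1 hx.2.ne)
  have h2 : StrictAntiOn (profile a) (Ici (headLength a)) := by
    refine strictAntiOn_of_deriv_neg (convex_Ici _) (continuous_profile ha).continuousOn
      fun x hx => ?_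
    rw [interior_Ici] at hx
    have h0 : 0 < x := hl.trans_lt hx
    rw [(hasDerivAt_profile ha (by rw [abs_of_pos h0]; exact ne_of_gt hx)).deriv]
    exact neg_neg_of_pos (waveSlope_pos ha h0 (ne_of_gt hx))
  rw [← Icc_union_Ici_eq_Ici hl]
  exact h1.union h2 (isGreatest_Icc hl) isLeast_Ici

theorem profile_lt_profile_zero (ha : 0 ≤ a) (hx : x ≠ 0) : profile a x < profile a 0 := by
  rw [← profile_abs ha x]
  exact strictAntiOn_profile ha (by simp) (by simp) (abs_pos.2 hx)

theorem image_profile_Ioo (ha : 0 ≤ a) {p q : ℝ} (hp : 0 ≤ p) (hpq : p ≤ q) :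
    profile a '' Ioo p q = Ioo (profile a q) (profile a p) := by
  refine Subset.antisymm ?_ (intermediate_value_Ioo' hpq (continuous_profile ha).continuousOn)
  rintro _ ⟨x, hx, rfl⟩
  have hx0 : x ∈ Ici (0 : ℝ) := hp.trans hx.1.le
  exact ⟨strictAntiOn_profile ha hx0 (hp.trans hpq) hx.2, strictAntiOn_profile ha hp hx0 hx.1⟩

/-- Separation of variables: if `g (U) |U'| = 1` on an interval on which the profile decreases, then
the integral of `g` over the range of `U` is the length of the interval. -/
theorem integral_profile (ha : 0 ≤ a) {p q : ℝ} (hp : 0 ≤ p) (hpq : p ≤ q) {g : ℝ → ℝ}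
    (hg : ∀ x ∈ Ioo p q, x ≠ headLength a ∧ g (profile a x) = (waveSlope a x)⁻¹) :
    ∫ ξ in (profile a q)..(profile a p), g ξ = q - p := by
  have hle : profile a q ≤ profile a p := (strictAntiOn_profile ha).antitoneOn hp (hp.trans hpq) hpq
  have h0 : ∀ x ∈ Ioo p q, 0 < x := fun x hx => hp.trans_lt hx.1
  rw [intervalIntegral.integral_of_le hle, integral_Ioc_eq_integral_Ioo,
    ← image_profile_Ioo ha hp hpq,
    integral_image_eq_integral_abs_deriv_smul (f' := fun x => -waveSlope a x) measurableSet_Ioo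
      (fun x hx => (hasDerivAt_profile ha (by
        rw [abs_of_pos (h0 x hx)]; exact (hg x hx).1)).hasDerivWithinAt)
      ((strictAntiOn_profile ha).injOn.mono fun x hx => (h0 x hx).le)]
  rw [setIntegral_congr_fun (g := fun _ => (1 : ℝ)) measurableSet_Ioo]
  · simp [hpq]
  · intro x hx
    have hpos := waveSlope_pos ha (h0 x hx) (hg x hx).1
    simp only [smul_eq_mul]
    rw [(hg x hx).2, abs_neg, abs_of_pos hpos, mul_inv_cancel₀ hpos.ne']

/-- On the tail `-log (1 - U²) = W²`, so the integrand is `1 / |U'|` and separation of variables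
applies. -/
theorem isCuspedSoliton_profile : IsCuspedSoliton (profile 0) := by
  intro x
  refine ⟨profile_pos le_rfl x, profile_le_one le_rfl (by rw [headLength_zero]; exact abs_nonneg x),
    ?_⟩
  have h := integral_profile (g := fun ξ => 1 / √(-Real.log (1 - ξ ^ 2))) le_rfl le_rfl
    (abs_nonneg x) (fun y hy => by
      have hy0 : 0 < y := hy.1
      have hgt : headLength 0 < |y| := by rw [headLength_zero, abs_of_pos hy0]; exact hy0
      have hne : y ≠ headLength 0 := by rw [headLength_zero]; exact hy0.ne'
      refine ⟨hne, ?_⟩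
      rw [profile_sq le_rfl, excess_of_gt le_rfl hgt, show ∀ r : ℝ, 1 - (1 + -r) = r by intro r; ring,
        Real.log_exp, neg_neg, Real.sqrt_sq (waveSlope_pos le_rfl hy0 hne).le, one_div])
  rw [profile_abs le_rfl, sub_zero, profile_zero le_rfl] at h
  simpa using h.symm

/-- On the head `log a - log (U² - 1) = W²`, so again the integrand is `1 / |U'|`. -/
theorem integral_head_profile (ha : 0 < a) (hx : |x| ≤ headLength a) :
    ∫ ξ in (1 : ℝ)..(profile a x), 1 / √(Real.log a - Real.log (ξ ^ 2 - 1))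
      = headLength a - |x| := by
  have hl : |headLength a| = headLength a := abs_of_pos (headLength_pos ha)
  have h := integral_profile (g := fun ξ => 1 / √(Real.log a - Real.log (ξ ^ 2 - 1))) ha.le
    (abs_nonneg x) hx (fun y hy => by
      have hy0 : 0 < y := (abs_nonneg x).trans_lt hy.1
      have hlt : |y| < headLength a := by rw [abs_of_pos hy0]; exact hy.2
      refine ⟨hy.2.ne, ?_⟩
      rw [profile_sq ha.le, excess_of_lt hlt, add_sub_cancel_left,
        Real.log_mul ha.ne' (Real.exp_pos _).ne', Real.log_exp,
        show ∀ r s : ℝ, r - (r + -s) = s by intro r s; ring,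
        Real.sqrt_sq (waveSlope_pos ha.le hy0 hy.2.ne).le, one_div])
  rwa [profile_abs ha.le, profile_of_eq hl] at h

theorem headWidth_eq (C : ℝ) : headWidth C = headLength (Real.exp (2 * C)) := by
  have ha := Real.exp_pos (2 * C)
  have h := integral_head_profile (x := 0) ha (by rw [abs_zero]; exact headLength_nonneg ha.le)
  rw [profile_zero ha.le, Real.log_exp, abs_zero, sub_zero] at h
  exact h

theorem isSoliton_profile (C : ℝ) : IsSoliton C (profile (Real.exp (2 * C))) := by
  have ha := Real.exp_pos (2 * C)
  rw [IsSoliton, headWidth_eq]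
  refine ⟨fun x hx => ⟨one_le_profile ha.le hx, profile_le_of_le ha.le hx, ?_⟩,
    profile 0, isCuspedSoliton_profile, fun x hx => profile_eq_profile_zero ha.le hx⟩
  rw [← integral_head_profile ha hx, Real.log_exp]

end Profile

/-! ### Integrals over the line as integrals over the slope. -/

section Integrals

variable {a : ℝ} {f h t : ℝ → ℝ}

theorem integral_head (ha : 0 ≤ a) (hf : ∀ x, |x| < headLength a → f x = h (headSlope a x))
    (hh : Integrable fun s => headKernel a s * h s) :
    IntegrableOn f (Ioo (-headLength a) (headLength a)) ∧
      ∫ x in Ioo (-headLength a) (headLength a), f x = ∫ s, headKernel a s * h s := by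
  rcases ha.eq_or_lt with rfl | ha'
  · simp [headLength_zero, headKernel_zero]
  have hd : ∀ s ∈ univ, HasDerivWithinAt (headPos a) (headKernel a s) univ s :=
    fun s _ => (hasDerivAt_headPos ha s).hasDerivWithinAt
  have hi := (strictMono_headPos ha').injective.injOn (s := univ)
  have e : (fun s => |headKernel a s| • f (headPos a s)) = fun s => headKernel a s * h s := by
    funext s
    have hs : |headPos a s| < headLength a := by
      have : headPos a s ∈ range (headPos a) := mem_range_self s
      rw [range_headPos ha'] at this
      exact abs_lt.2 this
    rw [hf _ hs, headSlope_headPos ha', abs_of_pos (headKernel_pos ha' s), smul_eq_mul]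
  rw [← range_headPos ha', ← image_univ,
    integrableOn_image_iff_integrableOn_abs_deriv_smul MeasurableSet.univ hd hi,
    integral_image_eq_integral_abs_deriv_smul MeasurableSet.univ hd hi, e, setIntegral_univ,
    integrableOn_univ]
  exact ⟨hh, rfl⟩

theorem integral_tail {ℓ σ : ℝ} (hσ : |σ| = 1)
    (hf : ∀ y, 0 < y → f (σ * (ℓ + y)) = t (tailSlope y))
    (ht : IntegrableOn (fun s => tailKernel s * t s) (Ioi 0)) :
    IntegrableOn f ((fun y => σ * (ℓ + y)) '' Ioi 0) ∧
      ∫ x in (fun y => σ * (ℓ + y)) '' Ioi 0, f x = ∫ s in Ioi 0, tailKernel s * t s := by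
  have hσ0 : σ ≠ 0 := by rintro rfl; simp at hσ
  have hd : ∀ s ∈ Ioi (0 : ℝ), HasDerivWithinAt (fun s => σ * (ℓ + tailPos s))
      (σ * -tailKernel s) (Ioi 0) s :=
    fun s hs => (((hasDerivAt_tailPos hs).const_add ℓ).const_mul σ).hasDerivWithinAt
  have hi : InjOn (fun s => σ * (ℓ + tailPos s)) (Ioi 0) := fun s hs r hr e =>
    strictAntiOn_tailPos.injOn hs hr (add_left_cancel (mul_left_cancel₀ hσ0 e))
  have e : EqOn (fun s => |σ * -tailKernel s| • f (σ * (ℓ + tailPos s)))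
      (fun s => tailKernel s * t s) (Ioi 0) := by
    intro s hs
    simp only
    rw [hf _ (tailPos_pos hs), tailSlope_tailPos hs, abs_mul, hσ, one_mul, abs_neg,
      abs_of_pos (tailKernel_pos (ne_of_gt hs)), smul_eq_mul]
  have himg : (fun y => σ * (ℓ + y)) '' Ioi 0 = (fun s => σ * (ℓ + tailPos s)) '' Ioi 0 := by
    conv_lhs => rw [← image_tailPos, image_image]
  rw [himg, integrableOn_image_iff_integrableOn_abs_deriv_smul measurableSet_Ioi hd hi,
    integral_image_eq_integral_abs_deriv_smul measurableSet_Ioi hd hi,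
    integrableOn_congr_fun e measurableSet_Ioi, setIntegral_congr_fun measurableSet_Ioi e]
  exact ⟨ht, rfl⟩

theorem ae_abs_ne (ℓ : ℝ) : ∀ᵐ x : ℝ, |x| ≠ ℓ := by
  filter_upwards [compl_mem_ae_iff.2 (measure_singleton (μ := volume) ℓ),
    compl_mem_ae_iff.2 (measure_singleton (μ := volume) (-ℓ))] with x h1 h2 h
  rcases abs_choice x with e | e
  · exact h1 (by rw [mem_singleton_iff, ← h, e])
  · exact h2 (by rw [mem_singleton_iff, ← h, e, neg_neg])

/-- Change of variables from the line to the slope. -/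
theorem integral_comp_slope (ha : 0 ≤ a)
    (hf : ∀ x, |x| < headLength a → f x = h (headSlope a x))
    (hf' : ∀ x, headLength a < |x| → f x = t (tailSlope (|x| - headLength a)))
    (hh : Integrable fun s => headKernel a s * h s)
    (ht : IntegrableOn (fun s => tailKernel s * t s) (Ioi 0)) :
    Integrable f ∧
      ∫ x, f x = (∫ s, headKernel a s * h s) + 2 * ∫ s in Ioi 0, tailKernel s * t s := by
  have hl := headLength_nonneg ha
  set ℓ := headLength a with hℓ
  have hR : (fun y => (1 : ℝ) * (ℓ + y)) '' Ioi 0 = Ioi ℓ := by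
    simp
  have hL : (fun y => (-1 : ℝ) * (ℓ + y)) '' Ioi 0 = Iio (-ℓ) := by
    have : (fun y => (-1 : ℝ) * (ℓ + y)) = fun y => -ℓ - y := by funext y; ring
    rw [this]; simp
  obtain ⟨i1, e1⟩ := integral_head ha hf hh
  obtain ⟨i2, e2⟩ := integral_tail (f := f) (ℓ := ℓ) (σ := 1) (by simp) (fun y hy => by
    have h1 : |1 * (ℓ + y)| = ℓ + y := by rw [one_mul, abs_of_pos (by linarith)]
    rw [hf' _ (by rw [h1]; linarith), h1, add_sub_cancel_left]) ht
  obtain ⟨i3, e3⟩ := integral_tail (f := f) (ℓ := ℓ) (σ := -1) (by simp) (fun y hy => by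
    have h1 : |-1 * (ℓ + y)| = ℓ + y := by rw [neg_one_mul, abs_neg, abs_of_pos (by linarith)]
    rw [hf' _ (by rw [h1]; linarith), h1, add_sub_cancel_left]) ht
  rw [hR] at i2 e2
  rw [hL] at i3 e3
  -- Head and the two tails cover the line except for the null set `|x| = ℓ`.
  have hS : volume.restrict (Ioo (-ℓ) ℓ ∪ (Ioi ℓ ∪ Iio (-ℓ))) = (volume : Measure ℝ) := by
    apply Measure.restrict_eq_self_of_ae_mem
    filter_upwards [ae_abs_ne ℓ] with x hx
    rcases lt_or_gt_of_ne hx with h1 | h1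
    · exact Or.inl (abs_lt.1 h1)
    · rcases lt_abs.1 h1 with h2 | h2
      · exact Or.inr (Or.inl h2)
      · exact Or.inr (Or.inr (by rw [mem_Iio]; linarith))
  have d1 : Disjoint (Ioi ℓ) (Iio (-ℓ)) := by
    rw [Set.disjoint_left]; intro x h1 h2
    rw [mem_Ioi] at h1; rw [mem_Iio] at h2; linarith
  have d2 : Disjoint (Ioo (-ℓ) ℓ) (Ioi ℓ ∪ Iio (-ℓ)) := by
    rw [Set.disjoint_left]; rintro x ⟨h1, h2⟩ (h3 | h3)
    · rw [mem_Ioi] at h3; linarith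
    · rw [mem_Iio] at h3; linarith
  have i4 := i1.union (i2.union i3)
  have e4 := setIntegral_union d2 (measurableSet_Ioi.union measurableSet_Iio) i1 (i2.union i3)
  rw [setIntegral_union d1 measurableSet_Iio i2 i3, hS, e1, e2, e3] at e4
  rw [IntegrableOn, hS] at i4
  exact ⟨i4, by rw [e4]; ring⟩

end Integrals

/-! ### Square integrability, the energy space and the flux. -/

section Soliton

variable {a : ℝ}

theorem integrable_headKernel_mul {a : ℝ} (ha : 0 ≤ a) {h : ℝ → ℝ} (hc : Continuous h)
    (hh : Integrable fun s => Real.exp (-s ^ 2) * h s) :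
    Integrable fun s => headKernel a s * h s := by
  refine (hh.const_mul a).mono ((continuous_headKernel ha).mul hc).aestronglyMeasurable
    (Eventually.of_forall fun s => ?_)
  rw [norm_mul, norm_mul, norm_mul, ← mul_assoc, Real.norm_of_nonneg (headKernel_nonneg ha s),
    Real.norm_of_nonneg ha, Real.norm_of_nonneg (Real.exp_pos _).le]
  gcongr
  exact headKernel_le ha s

theorem integrable_exp_mul_pow (n : ℕ) : Integrable fun s : ℝ => Real.exp (-s ^ 2) * s ^ n := by
  simpa [mul_comm] using integrable_pow_mul_exp_neg_sq n

/-- The exponent starts at one because a positive power of the slope is needed against the `1/s`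
singularity of `tailKernel`. The cases `n = 0` and `n = 1` place `U'` and `U'²` in `L²`. -/
theorem integral_slope_pow (ha : 0 ≤ a) (n : ℕ) :
    Integrable (fun x => (waveSlope a x ^ 2) ^ (n + 1)) ∧
      ∫ x, (waveSlope a x ^ 2) ^ (n + 1) = (∫ s, headKernel a s * (s ^ 2) ^ (n + 1))
        + 2 * ∫ s in Ioi 0, tailKernel s * (s ^ 2) ^ (n + 1) := by
  refine integral_comp_slope (h := fun s => (s ^ 2) ^ (n + 1)) (t := fun s => (s ^ 2) ^ (n + 1)) ha
    (fun x hx => by rw [waveSlope_of_lt hx]) (fun x hx => by rw [waveSlope_sq_of_gt ha hx]) ?_ ?_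
  · refine integrable_headKernel_mul ha (by fun_prop) ?_
    simpa [← pow_mul] using integrable_exp_mul_pow (2 * (n + 1))
  · refine (integrableOn_pow_mul_tailKernel (2 * n + 1)).congr_fun (fun s _ => ?_) measurableSet_Ioi
    ring

/-- On the tail `U² = 1 - e^{-s²} ≤ s²` compensates the singularity of the kernel. -/
theorem integral_profile_sq (ha : 0 ≤ a) :
    Integrable (fun x => profile a x ^ 2) ∧
      ∫ x, profile a x ^ 2 = (∫ s, headKernel a s * (1 + a * Real.exp (-s ^ 2)))
        + 2 * ∫ s in Ioi 0, tailKernel s * (1 - Real.exp (-s ^ 2)) := by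
  refine integral_comp_slope (h := fun s => 1 + a * Real.exp (-s ^ 2))
    (t := fun s => 1 - Real.exp (-s ^ 2)) ha
    (fun x hx => by rw [profile_sq ha, excess_of_lt hx, waveSlope_of_lt hx])
    (fun x hx => by rw [profile_sq ha, excess_of_gt ha hx, waveSlope_sq_of_gt ha hx]; ring) ?_ ?_
  · refine integrable_headKernel_mul ha (by fun_prop) ?_
    refine (integrable_exp_neg_sq.const_mul (1 + a)).mono' (by fun_prop)
      (Eventually.of_forall fun s => ?_)
    have : Real.exp (-s ^ 2) ≤ 1 := Real.exp_le_one_iff.2 (by nlinarith [sq_nonneg s])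
    rw [Real.norm_of_nonneg (by positivity), mul_comm]
    gcongr
    exact mul_le_of_le_one_right ha this
  · refine (integrableOn_pow_mul_tailKernel 1).mono'
      ((continuousOn_tailKernel.mul (by fun_prop)).aestronglyMeasurable measurableSet_Ioi)
      ((ae_restrict_mem measurableSet_Ioi).mono fun s hs => ?_)
    have hk := tailKernel_pos (ne_of_gt hs)
    rw [Real.norm_of_nonneg (mul_nonneg hk.le (one_sub_exp_pos (ne_of_gt hs)).le), mul_comm]
    exact mul_le_mul_of_nonneg_right (one_sub_exp_le s) hk.le

/-- The logarithm is `log a - W²` on the head and `-W²` on the tail, so its singularity at `U = 1`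
is only quadratic in the slope. -/
theorem integrable_log_abs_excess (ha : 0 ≤ a) :
    Integrable fun x => Real.log |excess a x| := by
  refine (integral_comp_slope (h := fun s => Real.log a - s ^ 2) (t := fun s => -s ^ 2) ha
    (fun x hx => ?_) (fun x hx => ?_) ?_ ?_).1
  · rw [Real.log_abs, excess_of_lt hx, waveSlope_of_lt hx,
      Real.log_mul (pos_of_abs_lt_headLength ha hx).ne' (Real.exp_pos _).ne', Real.log_exp]
    ring
  · rw [excess_of_gt ha hx, abs_neg, Real.abs_exp, Real.log_exp, waveSlope_sq_of_gt ha hx]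
  · refine integrable_headKernel_mul ha (by fun_prop) ?_
    simp only [mul_sub]
    exact (integrable_exp_neg_sq.mul_const _).sub (integrable_exp_mul_pow 2)
  · simp only [mul_neg]
    refine Integrable.neg ?_
    simpa [mul_comm, IntegrableOn] using integrableOn_pow_mul_tailKernel 1

theorem aestronglyMeasurable_waveSlope (ha : 0 ≤ a) :
    AEStronglyMeasurable (waveSlope a) volume := by
  refine ((measurable_deriv (profile a)).neg.aestronglyMeasurable).congr ?_
  filter_upwards [ae_abs_ne (headLength a)] with x hx
  rw [Pi.neg_apply, (hasDerivAt_profile ha hx).deriv, neg_neg]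

theorem memLp_waveSlope (ha : 0 ≤ a) : MemLp (waveSlope a) 2 :=
  (memLp_two_iff_integrable_sq (aestronglyMeasurable_waveSlope ha)).2 (by
    simpa using (integral_slope_pow ha 0).1)

theorem memLp_waveSlope_sq (ha : 0 ≤ a) : MemLp (fun x => waveSlope a x ^ 2) 2 :=
  (memLp_two_iff_integrable_sq ((aestronglyMeasurable_waveSlope ha).pow 2)).2
    (integral_slope_pow ha 1).1

theorem memLp_profile (ha : 0 ≤ a) : MemLp (profile a) 2 :=
  (memLp_two_iff_integrable_sq (continuous_profile ha).aestronglyMeasurable).2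
    (integral_profile_sq ha).1

theorem profile_le (ha : 0 ≤ a) (x : ℝ) : profile a x ≤ √(1 + a) := by
  rw [← profile_zero ha]
  rcases eq_or_ne x 0 with rfl | h
  · rfl
  · exact (profile_lt_profile_zero ha h).le

theorem memLp_profile_mul_sq (ha : 0 ≤ a) : MemLp (fun x => profile a x * waveSlope a x ^ 2) 2 := by
  refine (memLp_waveSlope_sq ha).of_le_mul (c := √(1 + a)) ((continuous_profile ha).aestronglyMeasurable.mul
    ((aestronglyMeasurable_waveSlope ha).pow 2)) (Eventually.of_forall fun x => ?_)
  rw [norm_mul, Real.norm_of_nonneg (profile_pos ha x).le]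
  gcongr
  exact profile_le ha x

theorem memLp_excess_mul_waveSlope (ha : 0 ≤ a) :
    MemLp (fun x => excess a x * waveSlope a x) 2 := by
  refine (memLp_waveSlope ha).of_le_mul (c := a + 1)
    (continuous_excess_mul_waveSlope ha).aestronglyMeasurable (Eventually.of_forall fun x => ?_)
  rw [norm_mul]
  gcongr
  refine (abs_excess_le ha x).trans (mul_le_of_le_one_right (by positivity) ?_)
  exact Real.exp_le_one_iff.2 (by nlinarith [sq_nonneg (waveSlope a x)])

theorem countable_abs_eq (ℓ : ℝ) : {x : ℝ | |x| = ℓ}.Countable := by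
  refine (Set.toFinite {ℓ, -ℓ}).countable.mono fun x hx => ?_
  rcases abs_choice x with h | h
  · left; rw [← h]; exact hx
  · right; rw [mem_singleton_iff, ← (show |x| = ℓ from hx), h, neg_neg]

theorem isIndefIntegral_profile (ha : 0 ≤ a) :
    IsIndefIntegral (profile a) (fun x => -waveSlope a x) :=
  .of_hasDerivAt_off_countable (countable_abs_eq (headLength a)) (continuous_profile ha)
    (fun _ hx => hasDerivAt_profile ha hx) ((memLp_waveSlope ha).neg.locallyIntegrable (by norm_num))

theorem memLp_flux_deriv (ha : 0 ≤ a) :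
    MemLp (fun x => profile a x - 2 * (profile a x * waveSlope a x ^ 2)) 2 :=
  (memLp_profile ha).sub ((memLp_profile_mul_sq ha).const_mul 2)

/-- The core of the weak formulation: `(1 - U²) U'` is continuous across the points where `U'` blows
up, so its distributional derivative is the pointwise one, without point masses. -/
theorem isIndefIntegral_flux (ha : 0 ≤ a) :
    IsIndefIntegral (fun x => excess a x * waveSlope a x)
      (fun x => profile a x - 2 * (profile a x * waveSlope a x ^ 2)) :=
  .of_hasDerivAt_off_countable (countable_abs_eq (headLength a)) (continuous_excess_mul_waveSlope ha)
    (fun _ hx => hasDerivAt_excess_mul_waveSlope ha hx)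
    ((memLp_flux_deriv ha).locallyIntegrable (by norm_num))

end Soliton

/-! ### Convergence in `L²`. -/

/-- Almost everywhere convergence together with convergence of the norms implies convergence in
`L²`, for functions that do not have opposite signs. -/
theorem tendsto_integral_sub_sq {ι : Type*} {l : Filter ι} [l.IsCountablyGenerated]
    {f : ι → ℝ → ℝ} {g : ℝ → ℝ} (hf : ∀ᶠ i in l, MemLp (f i) 2) (hg : MemLp g 2)
    (hsign : ∀ᶠ i in l, ∀ᵐ x, 0 ≤ f i x * g x)
    (hlim : ∀ᵐ x, Tendsto (fun i => f i x) l (𝓝 (g x)))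
    (hint : Tendsto (fun i => ∫ x, f i x ^ 2) l (𝓝 (∫ x, g x ^ 2))) :
    Tendsto (fun i => ∫ x, (f i x - g x) ^ 2) l (𝓝 0) := by
  have hmeas : ∀ i, MemLp (f i) 2 →
      AEStronglyMeasurable (fun x => min |f i x| |g x| ^ 2) volume := fun i hi =>
    (hi.aestronglyMeasurable.norm.inf hg.aestronglyMeasurable.norm).pow 2
  have hle : ∀ i x, ‖min |f i x| |g x| ^ 2‖ ≤ g x ^ 2 := fun i x => by
    rw [Real.norm_of_nonneg (by positivity), ← sq_abs (g x)]
    gcongr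
    exact min_le_right _ _
  -- The minimum is dominated by `|g|` whatever `i` is, although the `f i` have no common majorant.
  have hm : Tendsto (fun i => ∫ x, min |f i x| |g x| ^ 2) l (𝓝 (∫ x, g x ^ 2)) := by
    refine tendsto_integral_filter_of_dominated_convergence (fun x => g x ^ 2)
      (hf.mono fun i hi => hmeas i hi) (Eventually.of_forall fun i => Eventually.of_forall (hle i))
      hg.integrable_sq ?_
    filter_upwards [hlim] with x hx
    have := (hx.abs.min (tendsto_const_nhds (x := |g x|))).pow 2
    simpa using this
  have hup := (hint.add (tendsto_const_nhds (x := ∫ x, g x ^ 2))).sub (hm.const_mul 2)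
  rw [show (∫ x, g x ^ 2) + (∫ x, g x ^ 2) - 2 * ∫ x, g x ^ 2 = 0 by ring] at hup
  refine tendsto_of_tendsto_of_tendsto_of_le_of_le' tendsto_const_nhds hup
    (Eventually.of_forall fun i => integral_nonneg fun x => sq_nonneg _) ?_
  filter_upwards [hf, hsign] with i hi hs
  have hmi : Integrable (fun x => min |f i x| |g x| ^ 2) :=
    hg.integrable_sq.mono' (hmeas i hi) (Eventually.of_forall (hle i))
  have hadd : Integrable (fun x => f i x ^ 2 + g x ^ 2) := hi.integrable_sq.add hg.integrable_sq
  rw [← integral_const_mul, ← integral_add hi.integrable_sq hg.integrable_sq,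
    ← integral_sub hadd (hmi.const_mul 2)]
  refine integral_mono_ae (hi.sub hg).integrable_sq (hadd.sub (hmi.const_mul 2)) ?_
  filter_upwards [hs] with x hx
  -- Equal signs give `f g = |f| |g| ≥ min (|f|, |g|)²`, hence `(f - g)² ≤ f² + g² - 2 min (|f|,
  -- |g|)²`, whose integral tends to zero.
  have h1 : min |f i x| |g x| ^ 2 ≤ |f i x| * |g x| := by
    rw [sq]
    exact mul_le_mul (min_le_left _ _) (min_le_right _ _) (by positivity) (abs_nonneg _)
  rw [← abs_mul, abs_of_nonneg hx] at h1
  nlinarith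

theorem norm_toLp_sq {f : ℝ → ℝ} (hf : MemLp f 2 (volume : Measure ℝ)) :
    ‖hf.toLp f‖ ^ 2 = ∫ x, f x ^ 2 := by
  rw [← real_inner_self_eq_norm_sq, L2.inner_def]
  apply integral_congr_ae
  filter_upwards [hf.coeFn_toLp] with x hx
  rw [hx, real_inner_self_eq_norm_sq, Real.norm_eq_abs, sq_abs]

theorem tendsto_toLp {ι : Type*} {l : Filter ι} {f : ι → ℝ → ℝ} {g : ℝ → ℝ}
    (hf : ∀ i, MemLp (f i) 2 (volume : Measure ℝ)) (hg : MemLp g 2 (volume : Measure ℝ))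
    (h : Tendsto (fun i => ∫ x, (f i x - g x) ^ 2) l (𝓝 0)) :
    Tendsto (fun i => (hf i).toLp (f i)) l (𝓝 (hg.toLp g)) := by
  rw [tendsto_iff_norm_sub_tendsto_zero]
  have h2 := h.sqrt
  rw [Real.sqrt_zero] at h2
  refine h2.congr fun i => ?_
  rw [← MemLp.toLp_sub, ← Real.sqrt_sq (norm_nonneg (((hf i).sub hg).toLp (f i - g))), norm_toLp_sq]
  rfl

/-! ### Continuous dependence on the parameter `a`, including `a = 0`. -/

section Parameter

variable {a₀ : ℝ}

theorem tendsto_headKernel (ha : 0 ≤ a₀) (s : ℝ) :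
    Tendsto (fun a => headKernel a s) (𝓝[Ici 0] a₀) (𝓝 (headKernel a₀ s)) := by
  have h : ContinuousAt (fun a => headKernel a s) a₀ := by
    unfold headKernel
    refine ContinuousAt.div (by fun_prop) (by fun_prop) ?_
    have := one_le_sqrt_head ha s
    positivity
  exact h.tendsto.mono_left nhdsWithin_le_nhds

theorem eventually_nonneg_le (a₀ : ℝ) : ∀ᶠ a in 𝓝[Ici 0] a₀, 0 ≤ a ∧ a ≤ a₀ + 1 := by
  filter_upwards [self_mem_nhdsWithin,
    mem_nhdsWithin_of_mem_nhds (Iic_mem_nhds (lt_add_one a₀))] with a h1 h2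
  exact ⟨h1, h2⟩

theorem tendsto_integral_headKernel_mul (ha : 0 ≤ a₀) {h : ℝ → ℝ → ℝ} {B : ℝ → ℝ}
    (hc : ∀ a, Continuous (h a)) (hb : ∀ a s, 0 ≤ a → a ≤ a₀ + 1 → |h a s| ≤ B s)
    (hB : Integrable fun s => Real.exp (-s ^ 2) * B s)
    (hlim : ∀ s, Tendsto (fun a => h a s) (𝓝[Ici 0] a₀) (𝓝 (h a₀ s))) (S : Set ℝ) :
    Tendsto (fun a => ∫ s in S, headKernel a s * h a s) (𝓝[Ici 0] a₀)
      (𝓝 (∫ s in S, headKernel a₀ s * h a₀ s)) := by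
  refine tendsto_integral_filter_of_dominated_convergence
    (fun s => (a₀ + 1) * (Real.exp (-s ^ 2) * B s)) ?_ ?_ (hB.const_mul _).integrableOn
    (Eventually.of_forall fun s => (tendsto_headKernel ha s).mul (hlim s))
  · filter_upwards [eventually_nonneg_le a₀] with a h1
    exact ((continuous_headKernel h1.1).mul (hc a)).aestronglyMeasurable
  · filter_upwards [eventually_nonneg_le a₀] with a h1
    refine Eventually.of_forall fun s => ?_
    rw [norm_mul, Real.norm_of_nonneg (headKernel_nonneg h1.1 s), ← mul_assoc]
    refine mul_le_mul ((headKernel_le h1.1 s).trans ?_) (hb a s h1.1 h1.2) (norm_nonneg _)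
      (by positivity)
    gcongr
    exact h1.2

theorem tendsto_integral_headKernel (ha : 0 ≤ a₀) (S : Set ℝ) :
    Tendsto (fun a => ∫ s in S, headKernel a s) (𝓝[Ici 0] a₀) (𝓝 (∫ s in S, headKernel a₀ s)) := by
  simpa using tendsto_integral_headKernel_mul (h := fun _ _ => 1) (B := fun _ => 1) ha
    (fun _ => continuous_const) (by simp) (by simpa using integrable_exp_neg_sq)
    (fun _ => tendsto_const_nhds) S

theorem tendsto_headLength (ha : 0 ≤ a₀) :
    Tendsto headLength (𝓝[Ici 0] a₀) (𝓝 (headLength a₀)) :=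
  tendsto_integral_headKernel ha (Ioi 0)

theorem tendsto_headPos_param (ha : 0 ≤ a₀) (s : ℝ) :
    Tendsto (fun a => headPos a s) (𝓝[Ici 0] a₀) (𝓝 (headPos a₀ s)) :=
  (tendsto_integral_headKernel ha (Ioc 0 s)).sub (tendsto_integral_headKernel ha (Ioc s 0))

variable {x : ℝ}

/-- On the head, comparing the slope with `s` amounts to comparing `x` with `headPos a s`, so
convergence of `headPos` is enough. On the tail only the shift `headLength a` depends on `a`. -/
theorem tendsto_waveSlope (ha : 0 ≤ a₀) (hx : |x| ≠ headLength a₀) :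
    Tendsto (fun a => waveSlope a x) (𝓝[Ici 0] a₀) (𝓝 (waveSlope a₀ x)) := by
  rcases lt_or_gt_of_ne hx with h | h
  · have hev : ∀ᶠ a in 𝓝[Ici 0] a₀, 0 ≤ a ∧ |x| < headLength a :=
      ((eventually_nonneg_le a₀).mono fun _ h => h.1).and
        ((tendsto_headLength ha).eventually_const_lt h)
    rw [waveSlope_of_lt h]
    refine tendsto_order.2 ⟨fun s hs => ?_, fun s hs => ?_⟩
    · rw [lt_headSlope_iff ha h] at hs
      filter_upwards [hev, (tendsto_headPos_param ha s).eventually_lt_const hs] with a h1 h2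
      rwa [waveSlope_of_lt h1.2, lt_headSlope_iff h1.1 h1.2]
    · rw [gt_iff_lt, headSlope_lt_iff ha h] at hs
      filter_upwards [hev, (tendsto_headPos_param ha s).eventually_const_lt hs] with a h1 h2
      rwa [waveSlope_of_lt h1.2, headSlope_lt_iff h1.1 h1.2]
  · rw [waveSlope_of_gt h]
    have h1 := ((hasDerivAt_tailSlope (sub_pos.2 h)).continuousAt.tendsto.comp
      ((tendsto_headLength ha).const_sub |x|)).const_mul (Real.sign x)
    refine h1.congr' ?_
    filter_upwards [(tendsto_headLength ha).eventually_lt_const h] with a h2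
    rw [waveSlope_of_gt h2]
    rfl

theorem tendsto_profile (ha : 0 ≤ a₀) (hx : |x| ≠ headLength a₀) :
    Tendsto (fun a => profile a x) (𝓝[Ici 0] a₀) (𝓝 (profile a₀ x)) := by
  have hid : Tendsto (fun a : ℝ => a) (𝓝[Ici 0] a₀) (𝓝 a₀) := tendsto_id.mono_left nhdsWithin_le_nhds
  have hexp := (Real.continuous_exp.tendsto _).comp ((tendsto_waveSlope ha hx).pow 2).neg
  suffices Tendsto (fun a => excess a x) (𝓝[Ici 0] a₀) (𝓝 (excess a₀ x)) from
    (this.const_add 1).sqrt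
  rcases lt_or_gt_of_ne hx with h | h
  · rw [excess_of_lt h]
    refine (hid.mul hexp).congr' ?_
    filter_upwards [(tendsto_headLength ha).eventually_const_lt h] with a h1
    rw [excess_of_lt h1]
    rfl
  · rw [excess_of_gt ha h]
    refine hexp.neg.congr' ?_
    filter_upwards [(tendsto_headLength ha).eventually_lt_const h, eventually_nonneg_le a₀]
      with a h1 h2
    rw [excess_of_gt h2.1 h1]
    rfl

/-- Both slopes have the sign of `x`; this is the sign condition of `tendsto_integral_sub_sq`. -/
theorem waveSlope_mul_nonneg {a b : ℝ} (ha : 0 ≤ a) (hb : 0 ≤ b) (h1 : |x| ≠ headLength a)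
    (h2 : |x| ≠ headLength b) (h0 : x ≠ 0) : 0 ≤ waveSlope a x * waveSlope b x := by
  have key : 0 ≤ waveSlope a |x| * waveSlope b |x| :=
    mul_nonneg (waveSlope_pos ha (abs_pos.2 h0) h1).le (waveSlope_pos hb (abs_pos.2 h0) h2).le
  rcases abs_choice x with h | h <;> rw [h] at key
  · exact key
  · rwa [waveSlope_neg ha, waveSlope_neg hb, neg_mul_neg] at key

/-- Continuity of the profile in `L²` with respect to the parameter. -/
theorem tendsto_integral_profile_sub_sq (ha : 0 ≤ a₀) :
    Tendsto (fun a => ∫ x, (profile a x - profile a₀ x) ^ 2) (𝓝[Ici 0] a₀) (𝓝 0) := by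
  have hnn := (eventually_nonneg_le a₀).mono fun _ h => h.1
  refine tendsto_integral_sub_sq (hnn.mono fun a h => memLp_profile h) (memLp_profile ha)
    (hnn.mono fun a h => Eventually.of_forall fun x =>
      (mul_pos (profile_pos h x) (profile_pos ha x)).le) ?_ ?_
  · filter_upwards [ae_abs_ne (headLength a₀)] with x hx using tendsto_profile ha hx
  · rw [(integral_profile_sq ha).2]
    have h := tendsto_integral_headKernel_mul (h := fun a s => 1 + a * Real.exp (-s ^ 2))
      (B := fun _ => a₀ + 2) ha (fun a => by fun_prop) (fun a s h1 h2 => by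
        have : Real.exp (-s ^ 2) ≤ 1 := Real.exp_le_one_iff.2 (by nlinarith [sq_nonneg s])
        rw [abs_of_nonneg (by positivity)]
        linarith [mul_le_of_le_one_right h1 this]) (integrable_exp_neg_sq.mul_const _)
      (fun s => (tendsto_id.mono_left nhdsWithin_le_nhds |>.mul_const _).const_add 1) univ
    simp only [setIntegral_univ] at h
    refine (h.add_const _).congr' ?_
    filter_upwards [hnn] with a h1
    rw [(integral_profile_sq h1).2]

/-- Continuity of the derivative in `L²` with respect to the parameter. -/
theorem tendsto_integral_waveSlope_sub_sq (ha : 0 ≤ a₀) :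
    Tendsto (fun a => ∫ x, (waveSlope a x - waveSlope a₀ x) ^ 2) (𝓝[Ici 0] a₀) (𝓝 0) := by
  have hnn := (eventually_nonneg_le a₀).mono fun _ h => h.1
  refine tendsto_integral_sub_sq (hnn.mono fun a h => memLp_waveSlope h) (memLp_waveSlope ha)
    (hnn.mono fun a h => ?_) ?_ ?_
  · filter_upwards [ae_abs_ne (headLength a₀), ae_abs_ne (headLength a), ae_abs_ne 0]
      with x h1 h2 h3
    exact waveSlope_mul_nonneg h ha h2 h1 (by simpa using h3)
  · filter_upwards [ae_abs_ne (headLength a₀)] with x hx using tendsto_waveSlope ha hx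
  · have hsq : ∀ a, 0 ≤ a → ∫ x, waveSlope a x ^ 2 = (∫ s, headKernel a s * s ^ 2)
        + 2 * ∫ s in Ioi 0, tailKernel s * s ^ 2 := fun a h => by
      simpa using (integral_slope_pow h 0).2
    rw [hsq a₀ ha]
    have h := tendsto_integral_headKernel_mul (h := fun _ s => s ^ 2) (B := fun s => s ^ 2) ha
      (fun a => by fun_prop) (fun a s _ _ => by rw [abs_of_nonneg (sq_nonneg s)])
      (integrable_exp_mul_pow 2) (fun s => tendsto_const_nhds) univ
    simp only [setIntegral_univ] at h
    refine (h.add_const _).congr' ?_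
    filter_upwards [hnn] with a h1
    rw [hsq a h1]

end Parameter

/-! ### Rescaling to general `b` and `c`. -/

theorem quasiMeasurePreserving_mul_left {r : ℝ} (hr : r ≠ 0) :
    Measure.QuasiMeasurePreserving (fun x : ℝ => r * x) volume volume :=
  ⟨measurable_const_mul r, by
    rw [Real.map_volume_mul_left hr]
    exact Measure.smul_absolutelyContinuous⟩

section Scaling

variable {f F G : ℝ → ℝ} {r : ℝ}

theorem memLp_two_comp_mul_left (hf : MemLp f 2) (hr : r ≠ 0) (k : ℝ) :
    MemLp (fun x => k * f (r * x)) 2 := by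
  refine MemLp.const_mul ((memLp_two_iff_integrable_sq ?_).2 (hf.integrable_sq.comp_mul_left' hr)) k
  exact hf.aestronglyMeasurable.comp_quasiMeasurePreserving (quasiMeasurePreserving_mul_left hr)

theorem tendsto_integral_comp_mul_left {ι : Type*} {l : Filter ι} {f : ι → ℝ → ℝ} {g : ℝ → ℝ}
    (h : Tendsto (fun i => ∫ x, (f i x - g x) ^ 2) l (𝓝 0)) (k r : ℝ) :
    Tendsto (fun i => ∫ x, (k * f i (r * x) - k * g (r * x)) ^ 2) l (𝓝 0) := by
  have e : ∀ i, ∫ x, (k * f i (r * x) - k * g (r * x)) ^ 2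
      = k ^ 2 * (|r⁻¹| * ∫ x, (f i x - g x) ^ 2) := fun i => by
    have h1 := Measure.integral_comp_mul_left (fun x => (f i x - g x) ^ 2) r
    rw [smul_eq_mul] at h1
    rw [← h1, ← integral_const_mul]
    congr 1; funext x; ring
  simp only [e]
  simpa using (h.const_mul |r⁻¹|).const_mul (k ^ 2)

theorem IsIndefIntegral.comp_mul_left (h : IsIndefIntegral F G) (hG : MemLp G 2) (hr : r ≠ 0)
    (k : ℝ) : IsIndefIntegral (fun x => k * F (r * x)) (fun x => k * r * G (r * x)) where
  locallyIntegrable := (memLp_two_comp_mul_left hG hr _).locallyIntegrable (by norm_num)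
  sub_eq x y := by
    rw [intervalIntegral.integral_const_mul, mul_assoc, intervalIntegral.mul_integral_comp_mul_left,
      ← h.sub_eq, mul_sub]

end Scaling

/-! ### The solitons as elements of `H¹`. -/

section SolitonH1

variable {b c : ℝ}

/-- The soliton with parameter `a = e^{2C}` as an element of `H¹(ℝ)`. -/
def soliton (b : ℝ) (hc : 0 < c) (a : NNReal) : H1 :=
  ((isIndefIntegral_profile a.coe_nonneg).comp_mul_left (memLp_waveSlope a.coe_nonneg).neg (Real.sqrt_pos.2 hc).ne'
    (√b)⁻¹).toH1 (memLp_two_comp_mul_left (memLp_profile a.coe_nonneg) (Real.sqrt_pos.2 hc).ne' _)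
      (memLp_two_comp_mul_left (memLp_waveSlope a.coe_nonneg).neg (Real.sqrt_pos.2 hc).ne' _)

theorem h1Fun_soliton (b : ℝ) (hc : 0 < c) (a : NNReal) :
    h1Fun (soliton b hc a) =ᵐ[volume] fun x => (√b)⁻¹ * profile a (√c * x) :=
  IsIndefIntegral.h1Fun_toH1 _ _ _

theorem h1Deriv_soliton (b : ℝ) (hc : 0 < c) (a : NNReal) :
    h1Deriv (soliton b hc a) =ᵐ[volume] fun x => (√b)⁻¹ * √c * -waveSlope a (√c * x) :=
  IsIndefIntegral.h1Deriv_toH1 _ _ _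

theorem continuous_soliton (b : ℝ) (hc : 0 < c) : Continuous (soliton b hc) := by
  refine continuous_iff_continuousAt.2 fun a₀ => tendsto_subtype_rng.2 ?_
  have hcoe : Tendsto ((↑) : NNReal → ℝ) (𝓝 a₀) (𝓝[Ici 0] (a₀ : ℝ)) :=
    tendsto_nhdsWithin_iff.2 ⟨NNReal.continuous_coe.tendsto a₀, Eventually.of_forall fun a => a.coe_nonneg⟩
  have h1 := tendsto_toLp
    (fun a : NNReal => memLp_two_comp_mul_left (memLp_profile a.coe_nonneg) (Real.sqrt_pos.2 hc).ne' (√b)⁻¹)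
    (memLp_two_comp_mul_left (memLp_profile a₀.coe_nonneg) (Real.sqrt_pos.2 hc).ne' (√b)⁻¹)
    (tendsto_integral_comp_mul_left ((tendsto_integral_profile_sub_sq a₀.coe_nonneg).comp hcoe) _ _)
  have h2 := tendsto_toLp
    (fun a : NNReal => memLp_two_comp_mul_left (memLp_waveSlope a.coe_nonneg).neg (Real.sqrt_pos.2 hc).ne'
      ((√b)⁻¹ * √c))
    (memLp_two_comp_mul_left (memLp_waveSlope a₀.coe_nonneg).neg (Real.sqrt_pos.2 hc).ne' ((√b)⁻¹ * √c))
    (tendsto_integral_comp_mul_left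
      (f := fun (a : NNReal) x => -waveSlope a x) (g := fun x => -waveSlope a₀ x) (by
        refine ((tendsto_integral_waveSlope_sub_sq a₀.coe_nonneg).comp hcoe).congr fun a => ?_
        refine integral_congr_ae (Eventually.of_forall fun x => ?_)
        change (waveSlope a x - waveSlope a₀ x) ^ 2 = _
        ring) _ _)
  exact ((WithLp.prod_continuous_toLp 2 _ _).tendsto _).comp (h1.prodMk_nhds h2)

theorem isContRep_soliton (b : ℝ) (hc : 0 < c) (a : NNReal) :
    IsContRep (soliton b hc a) fun x => (√b)⁻¹ * profile a (√c * x) :=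
  ⟨continuous_const.mul ((continuous_profile a.coe_nonneg).comp (continuous_const.mul continuous_id)),
    h1Fun_soliton b hc a⟩

theorem isPositive_soliton (hb : 0 < b) (hc : 0 < c) (a : NNReal) :
    IsPositive (soliton b hc a) :=
  ⟨_, isContRep_soliton b hc a, fun _ =>
    mul_pos (inv_pos.2 (Real.sqrt_pos.2 hb)) (profile_pos a.coe_nonneg _)⟩

theorem isSingleHumped_soliton (hb : 0 < b) (hc : 0 < c) (a : NNReal) :
    IsSingleHumped (soliton b hc a) := by
  have hb' := inv_pos.2 (Real.sqrt_pos.2 hb)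
  refine ⟨_, isContRep_soliton b hc a, 0, fun x => ?_, fun y hy => ?_⟩
  · refine mul_le_mul_of_nonneg_left ?_ hb'.le
    rw [mul_zero, profile_zero a.coe_nonneg]
    exact profile_le a.coe_nonneg _
  · by_contra hne
    have h1 := le_of_mul_le_mul_left (hy 0) hb'
    rw [mul_zero] at h1
    exact h1.not_gt (profile_lt_profile_zero a.coe_nonneg (mul_ne_zero (Real.sqrt_pos.2 hc).ne' hne))

/-- Continuous representatives of the same class coincide, and their value at `0` is `√(1 + a) /
√b`. -/
theorem injective_soliton (hb : 0 < b) (hc : 0 < c) : Function.Injective (soliton b hc) := by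
  intro a a' h
  have e := (h1Fun_soliton b hc a).symm.trans (h ▸ h1Fun_soliton b hc a')
  have e0 := congrFun (((isContRep_soliton b hc a).1.ae_eq_iff_eq volume
    (isContRep_soliton b hc a').1).1 e) 0
  have e1 := mul_left_cancel₀ (inv_pos.2 (Real.sqrt_pos.2 hb)).ne' e0
  rw [mul_zero, profile_zero a.coe_nonneg, profile_zero a'.coe_nonneg,
    Real.sqrt_inj (by have := a.coe_nonneg; linarith) (by have := a'.coe_nonneg; linarith)] at e1
  exact NNReal.coe_injective (add_left_cancel e1)

theorem one_sub_mul_sq (hb : 0 < b) (a : NNReal) (y : ℝ) :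
    1 - b * ((√b)⁻¹ * profile a y) ^ 2 = -excess a y := by
  rw [mul_pow, inv_pow, Real.sq_sqrt hb.le, profile_sq a.coe_nonneg, ← mul_assoc, mul_inv_cancel₀ hb.ne']
  ring

theorem soliton_mem_energySpace (hb : 0 < b) (hc : 0 < c) (a : NNReal) :
    soliton b hc a ∈ energySpace b := by
  refine ((integrable_log_abs_excess a.coe_nonneg).comp_mul_left' (Real.sqrt_pos.2 hc).ne').congr ?_
  filter_upwards [h1Fun_soliton b hc a] with x hx
  rw [hx, one_sub_mul_sq hb, abs_neg]

theorem isWeakSolution_soliton (hb : 0 < b) (hc : 0 < c) (a : NNReal) :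
    IsWeakSolution b c (soliton b hc a) := by
  intro φ
  have hr : √c ≠ 0 := (Real.sqrt_pos.2 hc).ne'
  obtain ⟨Φ, hΦ, hΦe⟩ := exists_isIndefIntegral φ
  have hΦ2 : MemLp Φ 2 := (memLp_congr_ae hΦe).1 (h1Fun_memLp φ)
  have hv := memLp_two_comp_mul_left (memLp_profile_mul_sq a.coe_nonneg) hr ((√b)⁻¹ ^ 3 * c)
  -- The second term of the weak equation pairs the rescaled flux with `φ'`. Moving the derivative
  -- onto the flux cancels the other two terms.
  have hibp := ((isIndefIntegral_flux a.coe_nonneg).comp_mul_left (memLp_flux_deriv a.coe_nonneg) hr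
    ((√b)⁻¹ * √c)).integral_mul_eq_neg_of_memLp hΦ
    (memLp_two_comp_mul_left (memLp_excess_mul_waveSlope a.coe_nonneg) hr _)
    (memLp_two_comp_mul_left (memLp_flux_deriv a.coe_nonneg) hr _) hΦ2 (h1Deriv_memLp φ)
  have e1 : ∫ x, h1Fun (soliton b hc a) x * h1Fun φ x
      = ∫ x, (√b)⁻¹ * profile a (√c * x) * Φ x := by
    apply integral_congr_ae
    filter_upwards [h1Fun_soliton b hc a, hΦe] with x h1 h2
    rw [h1, h2]
  have e2 : ∫ x, (1 - b * h1Fun (soliton b hc a) x ^ 2) * h1Deriv (soliton b hc a) x * h1Deriv φ x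
      = ∫ x, (√b)⁻¹ * √c * (excess a (√c * x) * waveSlope a (√c * x)) * h1Deriv φ x := by
    apply integral_congr_ae
    filter_upwards [h1Fun_soliton b hc a, h1Deriv_soliton b hc a] with x h1 h2
    rw [h1, h2, one_sub_mul_sq hb]
    ring
  have e3 : ∫ x, h1Fun (soliton b hc a) x * h1Deriv (soliton b hc a) x ^ 2 * h1Fun φ x
      = ∫ x, (√b)⁻¹ ^ 3 * c * (profile a (√c * x) * waveSlope a (√c * x) ^ 2) * Φ x := by
    apply integral_congr_ae
    filter_upwards [h1Fun_soliton b hc a, h1Deriv_soliton b hc a, hΦe] with x h1 h2 h3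
    rw [h1, h2, h3, mul_pow, mul_pow, Real.sq_sqrt hc.le]
    ring
  rw [e1, e2, e3, hibp, ← integral_const_mul, ← integral_const_mul, ← sub_eq_add_neg, sub_sub,
    ← integral_add, sub_eq_zero]
  · refine integral_congr_ae (Eventually.of_forall fun x => ?_)
    have hbb : b * (√b)⁻¹ ^ 2 = 1 := by rw [inv_pow, Real.sq_sqrt hb.le, mul_inv_cancel₀ hb.ne']
    have hcc : √c * √c = c := Real.mul_self_sqrt hc.le
    simp only
    rw [mul_assoc (√b)⁻¹ √c √c, hcc]
    linear_combination (-2 * (√b)⁻¹ * c * profile a (√c * x) * waveSlope a (√c * x) ^ 2 * Φ x) * hbb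
  · exact (memLp_two_comp_mul_left (memLp_flux_deriv a.coe_nonneg) hr _).integrable_mul hΦ2
  · exact (hv.integrable_mul hΦ2).const_mul _

end SolitonH1

/-! ### The parameter on the extended real line. -/

/-- The parameter `a = e^{2C}`. -/
def amplitude (C : EReal) : NNReal := (EReal.exp C).toNNReal ^ 2

theorem amplitude_bot : amplitude ⊥ = 0 := by simp [amplitude]

theorem amplitude_coe (C : ℝ) : (amplitude C : ℝ) = Real.exp (2 * C) := by
  have h : ((EReal.exp C).toNNReal : ℝ) = Real.exp C := by
    rw [EReal.exp_coe]
    exact ENNReal.toReal_ofReal (Real.exp_pos C).le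
  rw [amplitude, NNReal.coe_pow, h, ← Real.exp_nat_mul]
  norm_num

theorem exp_ne_top_of_mem {C : EReal} (h : C ∈ Iio ⊤) : EReal.exp C ≠ ⊤ :=
  fun e => (ne_of_lt h) (EReal.exp_eq_top_iff.1 e)

/-- Continuity at `⊥` is included because `EReal.exp` is a homeomorphism onto `[0, ∞]`; only `⊤`,
where `toNNReal` jumps, is excluded. -/
theorem continuousOn_amplitude : ContinuousOn amplitude (Iio ⊤) :=
  (ENNReal.continuousOn_toNNReal.comp EReal.expHomeomorph.continuous.continuousOn
    fun _ h => exp_ne_top_of_mem h).pow 2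

theorem injOn_amplitude : InjOn amplitude (Iio ⊤) := by
  intro C h C' h' e
  have e1 := (pow_left_inj₀ zero_le zero_le two_ne_zero).1 e
  exact EReal.exp_strictMono.injective
    ((ENNReal.toNNReal_eq_toNNReal_iff' (exp_ne_top_of_mem h) (exp_ne_top_of_mem h')).1 e1)

end

theorem theorem1 (c : ℝ) (hc : 0 < c) :
    (∀ b : ℝ, b < 0 →
      ¬ ∃ u : H1, IsWeakSolution b c u ∧ IsPositive u ∧ IsSingleHumped u) ∧
    (∀ b : ℝ, 0 < b →
      ∃ u : EReal → H1,
        ContinuousOn u (Set.Iio ⊤) ∧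
        Set.InjOn u (Set.Iio ⊤) ∧
        (∀ C : EReal, C < ⊤ →
          IsWeakSolution b c (u C) ∧ IsPositive (u C) ∧ IsSingleHumped (u C) ∧
            u C ∈ energySpace b) ∧
        (∃ U : ℝ → ℝ, IsCuspedSoliton U ∧ IsRescaled b c (u ⊥) U) ∧
        (∀ C : ℝ, ∃ U : ℝ → ℝ, IsSoliton C U ∧ IsRescaled b c (u (C : EReal)) U)) := by
  refine ⟨fun b hb ⟨u, h1, h2, _⟩ => not_isPositive_of_neg hc hb h1 h2, fun b hb =>
    ⟨fun C => soliton b hc (amplitude C), (continuous_soliton b hc).comp_continuousOn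
      continuousOn_amplitude, (injective_soliton hb hc).comp_injOn injOn_amplitude,
      fun C _ => ⟨isWeakSolution_soliton hb hc _, isPositive_soliton hb hc _,
        isSingleHumped_soliton hb hc _, soliton_mem_energySpace hb hc _⟩,
      ⟨profile 0, isCuspedSoliton_profile, ?_⟩,
      fun C => ⟨profile (Real.exp (2 * C)), isSoliton_profile C, ?_⟩⟩⟩
  · have h := h1Fun_soliton b hc (amplitude ⊥)
    -- The round trip turns the coerced parameter of `profile` into the real number `0` and then
    -- restores `amplitude ⊥` inside `soliton`.
    rwa [amplitude_bot, NNReal.coe_zero, ← amplitude_bot] at h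
  · have h := h1Fun_soliton b hc (amplitude C)
    rwa [amplitude_coe] at h
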